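/- Let $T^2=S^1\times S^1$ with $S^1=\mathbb{R}/2\pi\mathbb{Z}$, let $\mathrm{pr}:\mathbb{R}^2\to T^2$ be the projection, and let $E\to T^2$ be a smooth oriented real vector bundle of rank $4$ with a smooth positive-definite metric $h$ and a smooth connection $\nabla$ satisfying $\nabla h=0$. Fix a positively oriented orthonormal basis $(v_i)$ of $E_{\mathrm{pr}(0,0)}$. Let $\xi_{i,x}$, $\xi_{i,y}$ be the $\nabla$-parallel sections of $\mathrm{pr}^*E$ along the lines $\{(x,0)\}$, $\{(0,y)\}$ with value $v_i$ at $(0,0)$, and let $A_1,A_2\in SO(4)$ be the matrices with $$(\xi_{1,x}\,\cdots\,\xi_{4,x})(a+2\pi,0)=(\xi_{1,x}\,\cdots\,\xi_{4,x})(a,0)\,A_1,\qquad (\xi_{1,y}\,\cdots\,\xi_{4,y})(0,b+2\pi)=(\xi_{1,y}\,\cdots\,\xi_{4,y})(0,b)\,A_2$$ for all $a,b\in\mathbb{R}$. The topological holonomy group $G_\nabla\subset SO(4)$ is the subgroup generated by $A_1$ and $A_2$; it is well defined up to conjugation in $SO(4)$. For $\varepsilon\in\{+,-\}$ let $\bigwedge^2_\varepsilon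 E\subset\bigwedge^2E$ be the rank $3$ subbundle with the local orthonormal frames $\frac1{\sqrt2}(e_1\wedge e_2+\varepsilon\, e_3\wedge e_4)$, $\frac1{\sqrt2}(e_1\wedge e_3+\varepsilon\, e_4\wedge e_2)$, $\frac1{\sqrt2}(e_1\wedge e_4+\varepsilon\, e_2\wedge e_3)$, where $(e_1,\dots,e_4)$ runs over the positively oriented local orthonormal frames of $E$; these frames define its orientation, and $\nabla$ induces a metric connection $\hat\nabla$ on it. Let $C_{\varepsilon,1},C_{\varepsilon,2}\in SO(3)$ be the matrices obtained from $(\bigwedge^2_\varepsilon E,\hat\nabla)$ and a positively oriented orthonormal basis of its fibre at $\mathrm{pr}(0,0)$ in the same way as $A_1,A_2$ are obtained from $(E,\nabla)$ and $(v_i)$. For $\varepsilon\in\{+,-\}$ and $k\in\{1,2\}$ suppose that $C_{\varepsilon,k}$ is the rotation by the angle $\theta_{\varepsilon,k}$ about a unit vector $p_{\varepsilon,k}\in\mathbb{R}^3$, that is, $C_{\varepsilon,k}=V\,C(\theta_{\varepsilon,k})\,{}^tV$ with $V\in SO(3)$ whose first column is $p_{\varepsilon,k}$ and $$C(\theta)=\begin{bmatrix}1&0&0\\0&\cos\theta&-\sin\theta\\0&\sin\theta&\cos\theta\end{bmatrix},$$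 and let $\phi_\varepsilon$ be the angle between $p_{\varepsilon,1}$ and $p_{\varepsilon,2}$. Suppose that $$\theta_{+,1}=q_1\pi,\quad \theta_{+,2}=\psi_2\pi,\quad \theta_{-,1}=\psi_1\pi,\quad \theta_{-,2}=q_2\pi,\quad \phi_+,\phi_-\in(0,\pi/2]$$ with $q_1,q_2\in\mathbb{Q}\setminus\mathbb{Z}$ and $\psi_1,\psi_2\in\mathbb{R}\setminus\mathbb{Q}$. Then $G_\nabla$ is dense in $SO(4)$. -/

import Mathlib

open scoped Manifold ContDiff Topology Bundle Real

noncomputable section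

namespace TorusHolonomy

/-! ### Two-forms on an oriented four-dimensional Euclidean space -/

section Fiber

variable {V : Type*} [NormedAddCommGroup V] [InnerProductSpace ℝ V]

/-- The decomposable bivector `a ∧ b`. -/
def wedge (a b : V) : ⋀[ℝ]^2 V := exteriorPower.ιMulti ℝ 2 ![a, b]

/-- For `ε = ±1` and a basis `e = (e₁, e₂, e₃, e₄)`, the three bivectors
`(e₁ ∧ e₂ + ε e₃ ∧ e₄) / √2`, `(e₁ ∧ e₃ + ε e₄ ∧ e₂) / √2`, `(e₁ ∧ e₄ + ε e₂ ∧ e₃) / √2`. -/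
def twistorFrame (ε : ℤˣ) (e : OrthonormalBasis (Fin 4) ℝ V) : Fin 3 → ⋀[ℝ]^2 V :=
  ![(1 / √2 : ℝ) • (wedge (e 0) (e 1) + ((ε : ℤ) : ℝ) • wedge (e 2) (e 3)),
    (1 / √2 : ℝ) • (wedge (e 0) (e 2) + ((ε : ℤ) : ℝ) • wedge (e 3) (e 1)),
    (1 / √2 : ℝ) • (wedge (e 0) (e 3) + ((ε : ℤ) : ℝ) • wedge (e 1) (e 2))]

/-- The subspace `⋀²_ε V` of (anti-)self-dual bivectors, spanned by the bivectors `twistorFrame ε e`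
of the positively oriented orthonormal bases `e`. -/
def selfDual (o : Orientation ℝ V (Fin 4)) (ε : ℤˣ) : Submodule ℝ (⋀[ℝ]^2 V) :=
  Submodule.span ℝ {w | ∃ e : OrthonormalBasis (Fin 4) ℝ V, e.toBasis.orientation = o ∧
    ∃ i, w = twistorFrame ε e i}

variable [FiniteDimensional ℝ V]

/-- The unit sphere of `⋀²_ε V`, for the inner product of `⋀² V` induced by that of `V`. -/
def twistorSphere (o : Orientation ℝ V (Fin 4)) (ε : ℤˣ) : Set (⋀[ℝ]^2 V) :=
  {w | w ∈ selfDual o ε ∧ ‖w‖ = 1}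

/-- `w` is an orthonormal basis of `⋀²_ε V` that gives the orientation of `⋀²_ε V`, which is the
one given by the frames `twistorFrame ε e`. -/
structure IsOrientedTwistorBasis (o : Orientation ℝ V (Fin 4)) (ε : ℤˣ)
    (w : Fin 3 → ⋀[ℝ]^2 V) : Prop where
  mem : ∀ i, w i ∈ selfDual o ε
  orthonormal : Orthonormal ℝ w
  orientation : ∀ e : OrthonormalBasis (Fin 4) ℝ V, e.toBasis.orientation = o →
    0 < (Matrix.of fun i j => inner ℝ (twistorFrame ε e i) (w j)).det

end Fiber

/-! ### The torus, and covariant differentiation along curves in it -/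

/-- The torus `T² = S¹ × S¹`. -/
abbrev Torus : Type := Circle × Circle

/-- The model with corners of the torus. -/
abbrev IT := (𝓡 1).prod (𝓡 1)

/-- The model fibre of a real vector bundle of rank `4`. -/
abbrev R4 := EuclideanSpace ℝ (Fin 4)

/-- The standard projection `ℝ² → T²`; its group of periods is `2πℤ × 2πℤ`. -/
def pr (p : ℝ × ℝ) : Torus := (Circle.exp p.1, Circle.exp p.2)

/-- The image in the torus of the line `l_x`. -/
abbrev curveX (t : ℝ) : Torus := pr (t, 0)

/-- The image in the torus of the line `l_y`. -/
abbrev curveY (t : ℝ) : Torus := pr (0, t)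

/-- The velocity of a curve in the torus. -/
def velocity (c : ℝ → Torus) (t : ℝ) : TangentSpace IT (c t) :=
  mfderiv 𝓘(ℝ, ℝ) IT c t (1 : ℝ)

/-- A family of sections `ξ₁, …, ξₙ` along a curve `c` of period `2π` satisfies
`(ξ₁(a+2π) … ξₙ(a+2π)) = (ξ₁(a) … ξₙ(a)) A` for all `a`. The fibres at `c (a + 2π)` and `c a` are
the same fibre, as expressed by the equality in the disjoint union of the fibres. -/
def HasMonodromy {G : Torus → Type*} [∀ b, AddCommGroup (G b)] [∀ b, Module ℝ (G b)]
    {n : ℕ} {c : ℝ → Torus} (ξ : Fin n → ∀ t, G (c t)) (A : Matrix (Fin n) (Fin n) ℝ) : Prop :=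
  ∀ (a : ℝ) (j : Fin n),
    (⟨c (a + 2 * π), ξ j (a + 2 * π)⟩ : Σ b, G b) = ⟨c a, ∑ i, A i j • ξ i a⟩

section Bundle

variable {E : Torus → Type*} [TopologicalSpace (Bundle.TotalSpace R4 E)]
  [∀ b, NormedAddCommGroup (E b)] [∀ b, InnerProductSpace ℝ (E b)] [FiberBundle R4 E]

/-- A choice of orientations of the fibres is an orientation of the bundle if around each point
there is a smooth frame that is positively oriented. -/
def IsBundleOrientation (o : ∀ b, Orientation ℝ (E b) (Fin 4)) : Prop :=
  ∀ b, ∃ u ∈ 𝓝 b, ∃ (s : Fin 4 → ∀ x, E x) (hs : IsLocalFrameOn IT R4 ∞ s u),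
    ∀ (x : Torus) (hx : x ∈ u), (hs.toBasisAt hx).orientation = o x

/-- `v` is the covariant derivative at time `t`, for the pull-back of the connection `nabla` by
`c`, of the section `ξ` along `c`: near `t` one can write `ξ = ∑ᵢ fᵢ (sᵢ ∘ c)` with functions `fᵢ`
and local sections `sᵢ` of the bundle, and `v = ∑ᵢ (fᵢ' sᵢ + fᵢ ∇_{c'} sᵢ)`. -/
def HasCovDerivAlongAt (nabla : CovariantDerivative IT R4 E) (c : ℝ → Torus)
    (ξ : ∀ t, E (c t)) (t : ℝ) (v : E (c t)) : Prop :=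
  ∃ (n : ℕ) (f : Fin n → ℝ → ℝ) (s : Fin n → ∀ b, E b),
    (∀ i, DifferentiableAt ℝ (f i) t) ∧
    (∀ i, ContMDiffAt IT (IT.prod 𝓘(ℝ, R4)) ∞
      (fun b => Bundle.TotalSpace.mk' R4 b (s i b)) (c t)) ∧
    (∀ᶠ τ in 𝓝 t, ξ τ = ∑ i, f i τ • s i (c τ)) ∧
    v = ∑ i, (deriv (f i) t • s i (c t) + f i t • nabla (s i) (c t) (velocity c t))

/-- `w` is the covariant derivative at time `t` of the section `Ω` of `⋀² E` along `c`, for the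
connection of `⋀² E` induced by `nabla`: near `t` one can write `Ω = ∑ₖ aₖ ∧ bₖ`, and
`w = ∑ₖ (∇aₖ ∧ bₖ + aₖ ∧ ∇bₖ)`. -/
def HasCovDerivAlongAt₂ (nabla : CovariantDerivative IT R4 E) (c : ℝ → Torus)
    (Ω : ∀ t, ⋀[ℝ]^2 (E (c t))) (t : ℝ) (w : ⋀[ℝ]^2 (E (c t))) : Prop :=
  ∃ (n : ℕ) (a b : Fin n → ∀ τ, E (c τ)) (a' b' : Fin n → E (c t)),
    (∀ k, HasCovDerivAlongAt nabla c (a k) t (a' k)) ∧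
    (∀ k, HasCovDerivAlongAt nabla c (b k) t (b' k)) ∧
    (∀ᶠ τ in 𝓝 t, Ω τ = ∑ k, wedge (a k τ) (b k τ)) ∧
    w = ∑ k, (wedge (a' k) (b k t) + wedge (a k t) (b' k))

/-- The section `ξ` of `E` along `c` is parallel. -/
def IsParallelAlong (nabla : CovariantDerivative IT R4 E) (c : ℝ → Torus)
    (ξ : ∀ t, E (c t)) : Prop :=
  ∀ t, HasCovDerivAlongAt nabla c ξ t 0

/-- `Ω` is a section along `c` of the twistor space (the bundle of unit spheres in `⋀²_ε E`) which
is horizontal for the connection induced by `nabla`. -/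
def IsHorizontalAlong [∀ b, FiniteDimensional ℝ (E b)] (nabla : CovariantDerivative IT R4 E)
    (o : ∀ b, Orientation ℝ (E b) (Fin 4)) (ε : ℤˣ) (c : ℝ → Torus)
    (Ω : ∀ t, ⋀[ℝ]^2 (E (c t))) : Prop :=
  ∀ t, Ω t ∈ twistorSphere (o (c t)) ε ∧ HasCovDerivAlongAt₂ nabla c Ω t 0

/-! ### Topological holonomy groups -/

/-- `A₁, A₂ ∈ SO(4)` are the matrices, with respect to some positively oriented orthonormal basis of
the fibre at `pr (0, 0)`, of the parallel transports of `nabla` along the two standard circles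
through `pr (0, 0)`. -/
def IsHolonomyPair (nabla : CovariantDerivative IT R4 E) (o : ∀ b, Orientation ℝ (E b) (Fin 4))
    (A₁ A₂ : Matrix.specialOrthogonalGroup (Fin 4) ℝ) : Prop :=
  ∃ (v : OrthonormalBasis (Fin 4) ℝ (E (pr (0, 0))))
    (ξx : Fin 4 → ∀ t, E (curveX t)) (ξy : Fin 4 → ∀ t, E (curveY t)),
    v.toBasis.orientation = o (pr (0, 0)) ∧
    (∀ i, IsParallelAlong nabla curveX (ξx i) ∧ ξx i 0 = v i) ∧
    (∀ i, IsParallelAlong nabla curveY (ξy i) ∧ ξy i 0 = v i) ∧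
    HasMonodromy ξx A₁.1 ∧ HasMonodromy ξy A₂.1

/-- `G` is the topological holonomy group of `nabla` at `pr (0, 0)` (which is determined up to
conjugation in `SO(4)`, by the choice of the basis): the subgroup generated by `A₁`, `A₂`. -/
def IsTopHolonomyGroup (nabla : CovariantDerivative IT R4 E)
    (o : ∀ b, Orientation ℝ (E b) (Fin 4))
    (G : Subgroup (Matrix.specialOrthogonalGroup (Fin 4) ℝ)) : Prop :=
  ∃ A₁ A₂, IsHolonomyPair nabla o A₁ A₂ ∧ G = Subgroup.closure {A₁, A₂}

/-- `C₁, C₂ ∈ SO(3)` are the matrices, with respect to some positively oriented orthonormal basis of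
the fibre of `⋀²_ε E` at `pr (0, 0)`, of the parallel transports of the connection induced by
`nabla` along the two standard circles through `pr (0, 0)`; they generate the topological holonomy
group of that connection in `⋀²_ε E`. -/
def IsTwistorHolonomyPair [∀ b, FiniteDimensional ℝ (E b)] (nabla : CovariantDerivative IT R4 E)
    (o : ∀ b, Orientation ℝ (E b) (Fin 4)) (ε : ℤˣ)
    (C₁ C₂ : Matrix.specialOrthogonalGroup (Fin 3) ℝ) : Prop :=
  ∃ (w : Fin 3 → ⋀[ℝ]^2 (E (pr (0, 0))))
    (Ωx : Fin 3 → ∀ t, ⋀[ℝ]^2 (E (curveX t))) (Ωy : Fin 3 → ∀ t, ⋀[ℝ]^2 (E (curveY t))),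
    IsOrientedTwistorBasis (o (pr (0, 0))) ε w ∧
    (∀ i, IsHorizontalAlong nabla o ε curveX (Ωx i) ∧ Ωx i 0 = w i) ∧
    (∀ i, IsHorizontalAlong nabla o ε curveY (Ωy i) ∧ Ωy i 0 = w i) ∧
    HasMonodromy (G := fun b => ⋀[ℝ]^2 (E b)) Ωx C₁.1 ∧
    HasMonodromy (G := fun b => ⋀[ℝ]^2 (E b)) Ωy C₂.1

end Bundle

/-! ### Rotations of three-dimensional space -/

/-- The rotation `C(θ)` about the first coordinate axis. -/
def rotMatrix (θ : ℝ) : Matrix (Fin 3) (Fin 3) ℝ :=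
  !![1, 0, 0; 0, Real.cos θ, -Real.sin θ; 0, Real.sin θ, Real.cos θ]

/-- `C` is the rotation with angle `θ` about the unit vector `p`: one has `C = V C(θ) ᵗV` for some
`V ∈ SO(3)` with first column `p`. -/
def IsRotation (C : Matrix.specialOrthogonalGroup (Fin 3) ℝ) (θ : ℝ)
    (p : EuclideanSpace ℝ (Fin 3)) : Prop :=
  ∃ V : Matrix.specialOrthogonalGroup (Fin 3) ℝ,
    C.1 = V.1 * rotMatrix θ * V.1.transpose ∧ ∀ i, p i = V.1 i 0

end TorusHolonomy

end

open TorusHolonomy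

/-! Pairs of unit quaternions act on `ℝ⁴ = ℍ` by multiplication from the left and from the right;
this is the double cover of `SO(4)`. Lift `A₁`, `A₂` to pairs `g`, `h`. Parallel transport preserves
the inner products of horizontal bivectors with the bivectors of parallel sections, so that, up to
a choice of basis, the monodromy of `⋀²_ε E` is the conjugation of pure quaternions by the
`ε`-component of the pair. Hence `h` has finite order in the `-` component and infinite order in
the `+` component.

Let `H` be the closure of the preimage of the holonomy group. A power of `h` is trivial in the `-`
component, so that `H` contains a circle of the `+` factor, and conjugation by `g` gives a second
circle about another axis. Among the axes of the circles in `H`, one that is as orthogonal as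
possible to a given one leads to two orthogonal axes, and circles about orthogonal axes generate
all unit quaternions. So `H` contains the `+` factor; once the `+` component of `g` is removed, the
same argument with `g` and `h` exchanged gives the `-` factor. -/

noncomputable section

namespace TorusHolonomy

open Quaternion Matrix
open scoped RealInnerProductSpace

/-! ### Unit quaternions and their circle subgroups -/

/-- The quaternionic imaginary units, that is, the pure quaternions of norm `1`. The subtype is the
one of `Complex.lift`: an imaginary unit is an embedding of `ℂ` into `ℍ`. -/
abbrev ImUnit : Type := {w : ℍ[ℝ] // w * w = -1}

theorem mem_unitary_iff_normSq_eq_one {x : ℍ[ℝ]} : x ∈ unitary ℍ[ℝ] ↔ normSq x = 1 := by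
  rw [Unitary.mem_iff, star_mul_self, self_mul_star, and_self, ← Quaternion.coe_one, coe_inj]

theorem real_inner_eq_neg_re_mul (x : ℍ[ℝ]) {y : ℍ[ℝ]} (hy : star y = -y) :
    ⟪x, y⟫ = -(x * y).re := by
  rw [Quaternion.inner_def, hy, mul_neg, re_neg]

theorem mul_add_mul_comm_of_pure {x y : ℍ[ℝ]} (hx : star x = -x) (hy : star y = -y) :
    x * y + y * x = ((-2 * ⟪x, y⟫ : ℝ) : ℍ[ℝ]) := by
  have h : y * x = star (x * y) := by rw [star_mul, hx, hy, neg_mul_neg]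
  rw [h, self_add_star', real_inner_eq_neg_re_mul x hy, neg_mul_neg]

theorem mul_eq_neg_mul_of_inner_eq_zero {x y : ℍ[ℝ]} (hx : star x = -x) (hy : star y = -y)
    (h : ⟪x, y⟫ = 0) : x * y = -(y * x) := by
  rw [eq_neg_iff_add_eq_zero, mul_add_mul_comm_of_pure hx hy, h, mul_zero, coe_zero]

theorem re_mul_comm (x y : ℍ[ℝ]) : (x * y).re = (y * x).re := by
  simp only [re_mul]
  ring

theorem inner_conj_conj (g : unitary ℍ[ℝ]) (x y : ℍ[ℝ]) :
    ⟪(g * x * star (g : ℍ[ℝ]) : ℍ[ℝ]), g * y * star (g : ℍ[ℝ])⟫ = ⟪x, y⟫ := by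
  have h : star (g : ℍ[ℝ]) * g = 1 := Unitary.star_mul_self_of_mem g.2
  rw [Quaternion.inner_def, Quaternion.inner_def, star_mul, star_mul, star_star, re_mul_comm]
  calc (g * (star y * star (g : ℍ[ℝ])) * (g * x * star (g : ℍ[ℝ]))).re
      = (g * (star y * (star (g : ℍ[ℝ]) * g) * x * star (g : ℍ[ℝ]))).re := by simp only [mul_assoc]
    _ = (star y * x).re := by
      rw [h, mul_one, ← mul_assoc, re_mul_comm, ← mul_assoc, ← mul_assoc, h, one_mul]
    _ = (x * star y).re := re_mul_comm _ _

namespace ImUnit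

theorem normSq_coe (w : ImUnit) : normSq (w : ℍ[ℝ]) = 1 := by
  have h : normSq (w : ℍ[ℝ]) * normSq (w : ℍ[ℝ]) = 1 := by rw [← map_mul, w.2, normSq_neg, map_one]
  nlinarith [normSq_nonneg (a := (w : ℍ[ℝ]))]

theorem norm_coe (w : ImUnit) : ‖(w : ℍ[ℝ])‖ = 1 := by
  rw [← sq_eq_sq₀ (norm_nonneg _) zero_le_one, sq, ← normSq_eq_norm_mul_self, normSq_coe, one_pow]

theorem star_coe (w : ImUnit) : star (w : ℍ[ℝ]) = -w := by
  have h : star (w : ℍ[ℝ]) * w = 1 := by rw [star_mul_self, normSq_coe, coe_one]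
  calc star (w : ℍ[ℝ]) = -(star (w : ℍ[ℝ]) * (w * w)) := by rw [w.2, mul_neg, mul_one, neg_neg]
    _ = -w := by rw [← mul_assoc, h, one_mul]

theorem coe_ne_zero (w : ImUnit) : (w : ℍ[ℝ]) ≠ 0 := norm_ne_zero_iff.1 (by simp [w.norm_coe])

theorem re_coe (w : ImUnit) : (w : ℍ[ℝ]).re = 0 := star_eq_neg.1 (star_coe w)

theorem normSq_smul_one_add_smul (w : ImUnit) (r s : ℝ) :
    normSq (r • (1 : ℍ[ℝ]) + s • (w : ℍ[ℝ])) = r ^ 2 + s ^ 2 := by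
  rw [normSq_add, normSq_smul, normSq_smul, w.normSq_coe, map_one, Quaternion.star_smul, w.star_coe]
  simp [w.re_coe]

theorem exists_eq_smul_one_add_smul_of_commute {x : ℍ[ℝ]} {w : ImUnit} (h : Commute x w) :
    ∃ r s : ℝ, x = r • (1 : ℍ[ℝ]) + s • (w : ℍ[ℝ]) := by
  refine ⟨x.re, ⟪x, w⟫, ?_⟩
  set y : ℍ[ℝ] := x - (x.re • (1 : ℍ[ℝ]) + ⟪x, w⟫ • (w : ℍ[ℝ])) with hy
  have hpure : star y = -y := star_eq_neg.2 (by simp [hy, w.re_coe])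
  have horth : ⟪y, (w : ℍ[ℝ])⟫ = 0 := by
    have h1 : ⟪(1 : ℍ[ℝ]), w⟫ = 0 := by
      rw [real_inner_eq_neg_re_mul _ w.star_coe, one_mul, w.re_coe, neg_zero]
    rw [hy, inner_sub_left, inner_add_left, inner_smul_left, inner_smul_left, h1,
      real_inner_self_eq_norm_sq, w.norm_coe]
    simp
  have hcomm : Commute y w :=
    h.sub_left (((Commute.one_left _).smul_left _).add_left ((Commute.refl _).smul_left _))
  have hanti : y * w = -(w * y) := mul_eq_neg_mul_of_inner_eq_zero hpure w.star_coe horth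
  have hzero : (2 : ℝ) • (y * w) = 0 := by
    rw [two_smul, ← eq_neg_iff_add_eq_zero, hcomm.eq, ← hanti, hcomm.eq]
  have hy0 : y = 0 := by simpa [w.coe_ne_zero] using hzero
  exact sub_eq_zero.1 hy0

theorem exists_commute (x : ℍ[ℝ]) : ∃ w : ImUnit, Commute x w := by
  by_cases h : x.im = 0
  · refine ⟨⟨(Complex.I : ℂ), by rw [← coeComplex_mul, Complex.I_mul_I]; ext <;> simp⟩, ?_⟩
    rw [← re_add_im x, h, add_zero]
    exact coe_commute _ _
  · refine ⟨⟨‖x.im‖⁻¹ • x.im, ?_⟩, ?_⟩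
    · rw [smul_mul_smul_comm, ← sq x.im, im_sq, normSq_eq_norm_mul_self, smul_neg,
        smul_coe]
      field_simp
      simp
    · refine Commute.smul_right ?_ _
      nth_rewrite 1 [← re_add_im x]
      exact (coe_commute _ _).add_left (Commute.refl _)

/-- The conjugate of an imaginary unit by a unit quaternion. -/
def conj (x : unitary ℍ[ℝ]) (w : ImUnit) : ImUnit :=
  ⟨x * w * star x, by
    have h : star (x : ℍ[ℝ]) * x = 1 := Unitary.star_mul_self_of_mem x.2
    calc (x * w * star (x : ℍ[ℝ]) * (x * w * star (x : ℍ[ℝ])) : ℍ[ℝ])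
        = x * w * (star (x : ℍ[ℝ]) * x) * w * star (x : ℍ[ℝ]) := by simp only [mul_assoc]
      _ = x * (w * w) * star (x : ℍ[ℝ]) := by rw [h, mul_one, mul_assoc (x : ℍ[ℝ])]
      _ = -1 := by rw [w.2, mul_neg_one, neg_mul, Unitary.mul_star_self_of_mem x.2]⟩

theorem coe_conj (x : unitary ℍ[ℝ]) (w : ImUnit) :
    (conj x w : ℍ[ℝ]) = x * w * star (x : ℍ[ℝ]) := rfl

instance : CompactSpace ImUnit := by
  have hbdd : Bornology.IsBounded {w : ℍ[ℝ] | w * w = -1} :=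
    isBounded_iff_forall_norm_le.2 ⟨1, fun w hw => (norm_coe ⟨w, hw⟩).le⟩
  exact isCompact_iff_compactSpace.1 (Metric.isCompact_of_isClosed_isBounded
    (isClosed_eq (by fun_prop) continuous_const) hbdd)

end ImUnit

open ImUnit

/-- The circle group of the unit quaternions `x + y w`, for an imaginary unit `w`. -/
def circleHom (w : ImUnit) : Circle →* unitary ℍ[ℝ] :=
  ((Complex.lift w : ℂ →* ℍ[ℝ]).comp Circle.coeHom).codRestrict (unitary ℍ[ℝ]) fun z => by
    rw [mem_unitary_iff_normSq_eq_one]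
    change normSq (algebraMap ℝ ℍ[ℝ] (z : ℂ).re + (z : ℂ).im • (w : ℍ[ℝ])) = 1
    rw [Algebra.algebraMap_eq_smul_one, w.normSq_smul_one_add_smul, ← Circle.normSq_coe z,
      Complex.normSq_apply, sq, sq]

theorem coe_circleHom (w : ImUnit) (z : Circle) :
    (circleHom w z : ℍ[ℝ]) = (z : ℂ).re • (1 : ℍ[ℝ]) + (z : ℂ).im • (w : ℍ[ℝ]) := by
  rw [← Algebra.algebraMap_eq_smul_one]
  rfl

theorem star_coe_circleHom (w : ImUnit) (z : Circle) :
    star (circleHom w z : ℍ[ℝ]) = (z : ℂ).re • (1 : ℍ[ℝ]) - (z : ℂ).im • (w : ℍ[ℝ]) := by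
  rw [coe_circleHom, star_add, Quaternion.star_smul, Quaternion.star_smul, star_one,
    w.star_coe, smul_neg, sub_eq_add_neg]

theorem continuous_circleHom (w : ImUnit) : Continuous (circleHom w) := by
  simp only [continuous_induced_rng, Function.comp_def, coe_circleHom]
  fun_prop

theorem continuous_circleHom_apply (z : Circle) : Continuous fun w => circleHom w z := by
  simp only [continuous_induced_rng, Function.comp_def, coe_circleHom]
  fun_prop

theorem circleHom_conj (x : unitary ℍ[ℝ]) (w : ImUnit) (z : Circle) :
    circleHom (conj x w) z = x * circleHom w z * x⁻¹ := by
  have h : (x : ℍ[ℝ]) * star (x : ℍ[ℝ]) = 1 := Unitary.mul_star_self_of_mem x.2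
  ext1
  rw [← Unitary.star_eq_inv, Submonoid.coe_mul, Submonoid.coe_mul, Unitary.coe_star, coe_circleHom,
    coe_circleHom, coe_conj, mul_add, add_mul, mul_smul_comm, smul_mul_assoc, mul_one, h,
    mul_smul_comm, smul_mul_assoc]

theorem exists_circleHom_eq_of_commute {x : unitary ℍ[ℝ]} {w : ImUnit}
    (h : Commute (x : ℍ[ℝ]) w) : ∃ z, circleHom w z = x := by
  obtain ⟨r, s, hx⟩ := exists_eq_smul_one_add_smul_of_commute h
  have hrs : r ^ 2 + s ^ 2 = 1 := by
    rw [← w.normSq_smul_one_add_smul, ← hx, mem_unitary_iff_normSq_eq_one.1 x.2]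
  have hz : ‖(⟨r, s⟩ : ℂ)‖ = 1 := by rw [Complex.norm_eq_sqrt_sq_add_sq, hrs, Real.sqrt_one]
  exact ⟨⟨⟨r, s⟩, mem_sphere_zero_iff_norm.2 hz⟩, Subtype.ext ((coe_circleHom _ _).trans hx.symm)⟩

theorem exists_circleHom_eq (x : unitary ℍ[ℝ]) : ∃ w z, circleHom w z = x :=
  let ⟨w, hw⟩ := exists_commute (x : ℍ[ℝ])
  ⟨w, exists_circleHom_eq_of_commute hw⟩

theorem circleHom_mul_of_inner_eq_zero {u w : ImUnit} (h : ⟪(u : ℍ[ℝ]), w⟫ = 0) (z : Circle) :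
    (circleHom u z * w : ℍ[ℝ]) = w * star (circleHom u z : ℍ[ℝ]) := by
  rw [star_coe_circleHom, coe_circleHom, add_mul, mul_sub, smul_mul_assoc, smul_mul_assoc,
    mul_smul_comm, mul_smul_comm, one_mul, mul_one,
    mul_eq_neg_mul_of_inner_eq_zero u.star_coe w.star_coe h, smul_neg, sub_eq_add_neg]

/-- The imaginary units whose circle group is contained in `K`. -/
def axes (K : Subgroup (unitary ℍ[ℝ])) : Set ImUnit := {w | ∀ z, circleHom w z ∈ K}

section Axes

variable {K : Subgroup (unitary ℍ[ℝ])} {u v w p : ImUnit}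

theorem conj_mem_axes {x : unitary ℍ[ℝ]} (hx : x ∈ K) (hw : w ∈ axes K) :
    conj x w ∈ axes K := fun z => by
  rw [circleHom_conj]
  exact K.mul_mem (K.mul_mem hx (hw z)) (K.inv_mem hx)

theorem isClosed_axes (hK : IsClosed (K : Set (unitary ℍ[ℝ]))) : IsClosed (axes K) := by
  simp only [axes, Set.ofPred_forall]
  exact isClosed_iInter fun z => hK.preimage (continuous_circleHom_apply z)

theorem continuous_conj (w : ImUnit) : Continuous fun x => conj x w := by
  simp only [continuous_induced_rng, Function.comp_def, coe_conj]
  fun_prop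

theorem conj_circleHom_self (u : ImUnit) (z : Circle) : conj (circleHom u z) u = u := by
  have h : Commute (circleHom u z : ℍ[ℝ]) u := by
    rw [coe_circleHom]
    exact ((Commute.one_left _).smul_left _).add_left ((Commute.refl _).smul_left _)
  ext1
  rw [coe_conj, h.eq, mul_assoc, Unitary.mul_star_self_of_mem (circleHom u z).2, mul_one]

theorem exists_conj_circleHom_eq_half_turn (u : ImUnit) :
    ∃ z, ∀ w, (conj (circleHom u z) w : ℍ[ℝ]) = (2 * ⟪(u : ℍ[ℝ]), w⟫) • (u : ℍ[ℝ]) - w := by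
  have hI : (circleHom u (Circle.exp (π / 2)) : ℍ[ℝ]) = u := by
    simp [coe_circleHom, Circle.coe_exp, Complex.exp_mul_I]
  refine ⟨Circle.exp (π / 2), fun w => ?_⟩
  have h : (u * w : ℍ[ℝ]) = ((-2 * ⟪(u : ℍ[ℝ]), w⟫ : ℝ) : ℍ[ℝ]) - w * u :=
    eq_sub_of_add_eq (mul_add_mul_comm_of_pure u.star_coe w.star_coe)
  rw [coe_conj, hI, u.star_coe, mul_neg, h, sub_mul, mul_assoc, u.2, coe_mul_eq_smul, neg_sub,
    mul_neg_one, neg_mul, neg_smul]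
  abel

theorem exists_inner_conj_circleHom_eq_zero
    (h : ⟪(w : ℍ[ℝ]), p⟫ * (2 * ⟪(u : ℍ[ℝ]), w⟫ * ⟪(u : ℍ[ℝ]), p⟫ - ⟪(w : ℍ[ℝ]), p⟫) ≤ 0) :
    ∃ z, ⟪(conj (circleHom u z) w : ℍ[ℝ]), p⟫ = 0 := by
  let f : Circle → ℝ := fun z => ⟪(conj (circleHom u z) w : ℍ[ℝ]), p⟫
  have hf : Continuous f :=
    (continuous_subtype_val.comp ((continuous_conj w).comp (continuous_circleHom u))).inner
      continuous_const
  have hone : f 1 = ⟪(w : ℍ[ℝ]), p⟫ := by simp [f, coe_conj]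
  obtain ⟨z, hz⟩ := exists_conj_circleHom_eq_half_turn u
  have hhalf : f z = 2 * ⟪(u : ℍ[ℝ]), w⟫ * ⟪(u : ℍ[ℝ]), p⟫ - ⟪(w : ℍ[ℝ]), p⟫ := by
    simp only [f, hz, inner_sub_left, real_inner_smul_left]
  rw [← hhalf, ← hone] at h
  rcases mul_nonpos_iff.1 h with ⟨h₁, h₂⟩ | ⟨h₁, h₂⟩
  · exact mem_range_of_exists_le_of_exists_ge hf ⟨z, h₂⟩ ⟨1, h₁⟩
  · exact mem_range_of_exists_le_of_exists_ge hf ⟨1, h₁⟩ ⟨z, h₂⟩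

theorem exists_conj_circleHom_eq (hu : ⟪(w : ℍ[ℝ]), u⟫ = 0) (hp : ⟪(w : ℍ[ℝ]), p⟫ = 0) :
    ∃ z, conj (circleHom w z) u = p := by
  have hup : Commute (p * star (u : ℍ[ℝ])) w := by
    have h₁ := mul_eq_neg_mul_of_inner_eq_zero w.star_coe u.star_coe hu
    have h₂ := mul_eq_neg_mul_of_inner_eq_zero w.star_coe p.star_coe hp
    rw [u.star_coe, mul_neg, Commute.neg_left_iff, commute_iff_eq, ← mul_assoc, h₂, mul_assoc,
      neg_mul, mul_assoc, h₁, mul_neg, neg_neg]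
  have hmem : (p * star (u : ℍ[ℝ])) ∈ unitary ℍ[ℝ] := by
    rw [mem_unitary_iff_normSq_eq_one, map_mul, normSq_star, u.normSq_coe, p.normSq_coe, one_mul]
  obtain ⟨z, hz⟩ := exists_circleHom_eq_of_commute (x := ⟨_, hmem⟩) hup
  -- Conjugation by `circleHom w ζ` multiplies `u` by `circleHom w (ζ ^ 2)`, so `ζ` has to be a
  -- square root of `p * star u`.
  obtain ⟨t, rfl⟩ := Circle.exp_surjective z
  refine ⟨Circle.exp (t / 2), Subtype.ext ?_⟩
  rw [coe_conj, mul_assoc, ← circleHom_mul_of_inner_eq_zero hu, ← mul_assoc, ← Submonoid.coe_mul,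
    ← map_mul, ← Circle.exp_add, add_halves, hz, mul_assoc, star_mul_self, u.normSq_coe, coe_one,
    mul_one]

theorem eq_top_of_orthogonal_axes (hu : u ∈ axes K) (hw : w ∈ axes K)
    (huw : ⟪(u : ℍ[ℝ]), w⟫ = 0) : K = ⊤ := by
  suffices h : ∀ p, p ∈ axes K by
    refine (Subgroup.eq_top_iff' K).2 fun x => ?_
    obtain ⟨p, z, rfl⟩ := exists_circleHom_eq x
    exact h p z
  intro p
  obtain ⟨z, hz⟩ : ∃ z, ⟪(conj (circleHom u z) w : ℍ[ℝ]), p⟫ = 0 := by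
    refine exists_inner_conj_circleHom_eq_zero ?_
    rw [huw, mul_zero, zero_mul, zero_sub, mul_neg, neg_nonpos]
    exact mul_self_nonneg _
  have hz' : ⟪(conj (circleHom u z) w : ℍ[ℝ]), u⟫ = 0 := by
    have h : ⟪(conj (circleHom u z) w : ℍ[ℝ]), conj (circleHom u z) u⟫ = ⟪(w : ℍ[ℝ]), u⟫ :=
      inner_conj_conj _ _ _
    rwa [conj_circleHom_self, real_inner_comm (u : ℍ[ℝ]) w, huw] at h
  obtain ⟨ζ, rfl⟩ := exists_conj_circleHom_eq hz' hz
  exact conj_mem_axes (conj_mem_axes (hu z) hw ζ) hu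

theorem inner_sq_lt_one_of_not_commute (h : ¬ Commute (u : ℍ[ℝ]) w) :
    ⟪(u : ℍ[ℝ]), w⟫ ^ 2 < 1 := by
  have hle : |⟪(u : ℍ[ℝ]), w⟫| ≤ 1 := by
    simpa only [ImUnit.norm_coe, mul_one] using abs_real_inner_le_norm (u : ℍ[ℝ]) w
  refine (sq_lt_one_iff_abs_lt_one _).2 (hle.lt_of_ne fun heq => h ?_)
  rcases eq_or_eq_neg_of_abs_eq heq with h1 | h1
  · rw [(inner_eq_one_iff_of_norm_eq_one u.norm_coe w.norm_coe).1 h1]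
  · rw [(inner_eq_neg_one_iff_of_norm_eq_one u.norm_coe w.norm_coe).1 h1]
    exact (Commute.refl _).neg_left

theorem exists_orthogonal_axes (hK : IsClosed (K : Set (unitary ℍ[ℝ]))) (hu : u ∈ axes K)
    (hw : w ∈ axes K) (huw : ¬ Commute (u : ℍ[ℝ]) w) :
    ∃ v ∈ axes K, ∃ v' ∈ axes K, ⟪(v : ℍ[ℝ]), v'⟫ = 0 := by
  obtain ⟨v, hv, hmin⟩ := (isClosed_axes hK).isCompact.exists_isMinOn ⟨w, hw⟩
    (f := fun v : ImUnit => ⟪(u : ℍ[ℝ]), v⟫ ^ 2) (by fun_prop)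
  have hvw : ⟪(u : ℍ[ℝ]), v⟫ ^ 2 < 1 := (hmin hw).trans_lt (inner_sq_lt_one_of_not_commute huw)
  -- The half turn about `v` doubles the angle between `u` and its image, which by minimality forces
  -- `2 * ⟪u, v⟫ ^ 2 ≤ 1`: the orbit of `u` under the rotations about `v` meets the plane `uᗮ`.
  obtain ⟨z, hz⟩ := exists_conj_circleHom_eq_half_turn v
  have hhalf : ⟪(u : ℍ[ℝ]), v⟫ ^ 2 ≤ ⟪(u : ℍ[ℝ]), conj (circleHom v z) u⟫ ^ 2 :=
    hmin (conj_mem_axes (hv z) hu)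
  rw [hz, inner_sub_right, inner_smul_right, real_inner_self_eq_norm_sq, u.norm_coe,
    real_inner_comm] at hhalf
  obtain ⟨ζ, hζ⟩ : ∃ ζ, ⟪(conj (circleHom v ζ) u : ℍ[ℝ]), u⟫ = 0 := by
    refine exists_inner_conj_circleHom_eq_zero ?_
    rw [real_inner_self_eq_norm_sq, u.norm_coe]
    rw [real_inner_comm] at hvw
    nlinarith
  exact ⟨_, conj_mem_axes (hv ζ) hu, u, hu, hζ⟩

end Axes

theorem eq_top_of_isClosed_of_not_isOfFinOrder {S : Subgroup Circle}
    (hS : IsClosed (S : Set Circle)) {z : Circle} (hz : z ∈ S) (hord : ¬ IsOfFinOrder z) :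
    S = ⊤ := by
  let e : UnitAddCircle ≃ₜ Circle := AddCircle.homeomorphCircle one_ne_zero
  have hpow (a : UnitAddCircle) (n : ℤ) : e (n • a) = e a ^ n := by
    simp only [e, AddCircle.homeomorphCircle_apply, AddCircle.toCircle_zsmul]
  obtain ⟨a, rfl⟩ := e.surjective z
  have hmultiples : DenseRange fun n : ℤ => n • a := by
    rw [AddCircle.denseRange_zsmul_iff, addOrderOf_eq_zero_iff,
      isOfFinAddOrder_iff_zsmul_eq_zero]
    rintro ⟨n, hn, hna⟩
    refine hord (isOfFinOrder_iff_zpow_eq_one.2 ⟨n, hn, ?_⟩)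
    rw [← hpow, hna, AddCircle.homeomorphCircle_apply, AddCircle.toCircle_zero]
  have hrange : Set.range (e ∘ fun n : ℤ => n • a) ⊆ S := by
    rintro _ ⟨n, rfl⟩
    rw [Function.comp_apply, hpow]
    exact S.zpow_mem hz n
  have hdense : Dense (S : Set Circle) :=
    (e.surjective.denseRange.comp hmultiples e.continuous).mono hrange
  exact SetLike.coe_injective (hS.closure_eq.symm.trans hdense.closure_eq)

theorem mem_axes_of_pow_mem {K : Subgroup (unitary ℍ[ℝ])}
    (hK : IsClosed (K : Set (unitary ℍ[ℝ]))) {w : ImUnit} {z : Circle}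
    (hord : ¬ IsOfFinOrder (circleHom w z)) {n : ℕ} (hn : n ≠ 0) (hmem : circleHom w z ^ n ∈ K) :
    w ∈ axes K := by
  have hz : ¬ IsOfFinOrder (z ^ n) := fun h => hord ((circleHom w).isOfFinOrder (h.of_pow hn))
  have htop : K.comap (circleHom w) = ⊤ :=
    eq_top_of_isClosed_of_not_isOfFinOrder (hK.preimage (continuous_circleHom w))
      (by rwa [Subgroup.mem_comap, map_pow]) hz
  exact fun ζ => Subgroup.mem_comap.1 (htop ▸ Subgroup.mem_top ζ)

theorem commute_circleHom_circleHom {u w : ImUnit} (h : Commute (u : ℍ[ℝ]) w) (z ζ : Circle) :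
    Commute (circleHom u z) (circleHom w ζ) := by
  have h' : Commute (circleHom u z : ℍ[ℝ]) (circleHom w ζ) := by
    rw [coe_circleHom, coe_circleHom]
    exact ((Commute.one_left _).smul_left _).add_left
      (((Commute.one_right _).smul_right _).add_right (h.smul_right _) |>.smul_left _)
  exact Subtype.ext h'

theorem eq_top_of_pow_mem_of_pow_mem {K : Subgroup (unitary ℍ[ℝ])}
    (hK : IsClosed (K : Set (unitary ℍ[ℝ]))) {x y : unitary ℍ[ℝ]} (hx : ¬ IsOfFinOrder x)
    (hy : ¬ IsOfFinOrder y) (hxy : ¬ Commute x y) {m n : ℕ} (hm : m ≠ 0) (hn : n ≠ 0)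
    (hxm : x ^ m ∈ K) (hyn : y ^ n ∈ K) : K = ⊤ := by
  obtain ⟨u, z, rfl⟩ := exists_circleHom_eq x
  obtain ⟨w, ζ, rfl⟩ := exists_circleHom_eq y
  obtain ⟨v, hv, v', hv', hvv'⟩ := exists_orthogonal_axes hK (mem_axes_of_pow_mem hK hx hm hxm)
    (mem_axes_of_pow_mem hK hy hn hyn) fun h => hxy (commute_circleHom_circleHom h z ζ)
  exact eq_top_of_orthogonal_axes hv hv' hvv'

section Pi

variable {ι : Type*} [DecidableEq ι] {H : Subgroup (ι → unitary ℍ[ℝ])}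

theorem mulSingle_mem_of_not_commute_conj (hH : IsClosed (H : Set (ι → unitary ℍ[ℝ])))
    {g h : ι → unitary ℍ[ℝ]} (hg : g ∈ H) (hh : h ∈ H) {i : ι} (hord : ¬ IsOfFinOrder (h i))
    (hcomm : ¬ Commute (h i) (g i * h i * (g i)⁻¹)) {n : ℕ} (hn : n ≠ 0)
    (hpow : ∀ j ≠ i, h j ^ n = 1) (x : unitary ℍ[ℝ]) : Pi.mulSingle i x ∈ H := by
  let K : Subgroup (unitary ℍ[ℝ]) := H.comap (MonoidHom.mulSingle (fun _ => unitary ℍ[ℝ]) i)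
  have hK : IsClosed (K : Set (unitary ℍ[ℝ])) := hH.preimage (continuous_mulSingle i)
  have hsingle : h ^ n = Pi.mulSingle i (h i ^ n) := by
    ext1 j
    rcases eq_or_ne j i with rfl | hj
    · simp
    · simp [hj, hpow j hj]
  have hconj : g * h ^ n * g⁻¹ = Pi.mulSingle i ((g i * h i * (g i)⁻¹) ^ n) := by
    ext1 j
    rcases eq_or_ne j i with rfl | hj
    · simp
    · simp [hj, hpow j hj]
  have hmem : h i ^ n ∈ K := by
    change Pi.mulSingle i (h i ^ n) ∈ H
    exact hsingle ▸ H.pow_mem hh n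
  have hmem' : (g i * h i * (g i)⁻¹) ^ n ∈ K := by
    change Pi.mulSingle i ((g i * h i * (g i)⁻¹) ^ n) ∈ H
    exact hconj ▸ H.mul_mem (H.mul_mem hg (H.pow_mem hh n)) (H.inv_mem hg)
  have hord' : ¬ IsOfFinOrder (g i * h i * (g i)⁻¹) :=
    fun hfin => hord ((isConj_iff.2 ⟨g i, rfl⟩ : IsConj (h i) _).symm.isOfFinOrder hfin)
  have htop : K = ⊤ := eq_top_of_pow_mem_of_pow_mem hK hord hord' hcomm hn hn hmem hmem'
  exact Subgroup.mem_comap.1 (htop ▸ Subgroup.mem_top x)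

end Pi

theorem eq_top_of_not_commute_conj {H : Subgroup (ℤˣ → unitary ℍ[ℝ])}
    (hH : IsClosed (H : Set (ℤˣ → unitary ℍ[ℝ]))) {g h : ℤˣ → unitary ℍ[ℝ]} (hg : g ∈ H)
    (hh : h ∈ H) (hfin : IsOfFinOrder (h (-1))) (hord : ¬ IsOfFinOrder (h 1))
    (hcomm : ¬ Commute (h 1) (g 1 * h 1 * (g 1)⁻¹)) (hord' : ¬ IsOfFinOrder (g (-1)))
    (hcomm' : ¬ Commute (g (-1)) (h (-1) * g (-1) * (h (-1))⁻¹)) : H = ⊤ := by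
  obtain ⟨n, hn, hpow⟩ := isOfFinOrder_iff_pow_eq_one.1 hfin
  have hone : ∀ x, Pi.mulSingle (1 : ℤˣ) x ∈ H := by
    refine mulSingle_mem_of_not_commute_conj hH hg hh hord hcomm hn.ne' fun j hj => ?_
    rwa [(Int.units_eq_one_or j).resolve_left hj]
  have hg' : g * Pi.mulSingle 1 (g 1)⁻¹ ∈ H := H.mul_mem hg (hone _)
  have hne : (-1 : ℤˣ) ≠ 1 := by decide
  have hneg : ∀ x, Pi.mulSingle (-1 : ℤˣ) x ∈ H := by
    refine mulSingle_mem_of_not_commute_conj hH hh hg' ?_ ?_ one_ne_zero fun j hj => ?_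
    · simpa [hne] using hord'
    · simpa [hne] using hcomm'
    · simp [(Int.units_eq_one_or j).resolve_right hj]
  refine (Subgroup.eq_top_iff' H).2 fun x => Subgroup.pi_mem_of_mulSingle_mem x fun ε => ?_
  rcases Int.units_eq_one_or ε with rfl | rfl
  exacts [hone _, hneg _]

/-! ### The double cover of `SO(4)` -/

/-- The matrix, in the basis `1, i, j, k` of the quaternions, of `x ↦ a * x` for `ε = 1` and of
`x ↦ x * star a` for `ε = -1`. -/
def mulMatrix (ε : ℤˣ) : ℍ[ℝ] →ₗ[ℝ] Matrix (Fin 4) (Fin 4) ℝ where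
  toFun a :=
    !![a.re, -((ε : ℤ) * a.imI), -((ε : ℤ) * a.imJ), -((ε : ℤ) * a.imK);
      (ε : ℤ) * a.imI, a.re, -a.imK, a.imJ;
      (ε : ℤ) * a.imJ, a.imK, a.re, -a.imI;
      (ε : ℤ) * a.imK, -a.imJ, a.imI, a.re]
  map_add' a b := by
    ext i j
    fin_cases i <;> fin_cases j <;> simp <;> ring
  map_smul' r a := by
    ext i j
    fin_cases i <;> fin_cases j <;> simp <;> ring

theorem mulMatrix_apply (ε : ℤˣ) (a : ℍ[ℝ]) :
    mulMatrix ε a =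
      !![a.re, -((ε : ℤ) * a.imI), -((ε : ℤ) * a.imJ), -((ε : ℤ) * a.imK);
        (ε : ℤ) * a.imI, a.re, -a.imK, a.imJ;
        (ε : ℤ) * a.imJ, a.imK, a.re, -a.imI;
        (ε : ℤ) * a.imK, -a.imJ, a.imI, a.re] := rfl

theorem mulMatrix_injective (ε : ℤˣ) : Function.Injective (mulMatrix ε) := by
  intro x y h
  have hentry (i j : Fin 4) : mulMatrix ε x i j = mulMatrix ε y i j := by rw [h]
  ext
  · simpa [mulMatrix_apply] using hentry 0 0
  · simpa [mulMatrix_apply] using hentry 2 3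
  · simpa [mulMatrix_apply] using hentry 1 3
  · simpa [mulMatrix_apply] using hentry 2 1

theorem mulMatrix_one (ε : ℤˣ) : mulMatrix ε 1 = 1 := by
  ext i j
  fin_cases i <;> fin_cases j <;> simp [mulMatrix_apply]

theorem mulMatrix_mul (ε : ℤˣ) (a b : ℍ[ℝ]) :
    mulMatrix ε (a * b) = mulMatrix ε a * mulMatrix ε b := by
  rcases Int.units_eq_one_or ε with rfl | rfl <;> ext i j <;> fin_cases i <;> fin_cases j <;>
    simp [mulMatrix_apply, Matrix.mul_apply, Fin.sum_univ_four] <;> ring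

theorem mulMatrix_star (ε : ℤˣ) (a : ℍ[ℝ]) : mulMatrix ε (star a) = (mulMatrix ε a)ᵀ := by
  ext i j
  fin_cases i <;> fin_cases j <;> simp [mulMatrix_apply]

theorem commute_mulMatrix (a b : ℍ[ℝ]) : Commute (mulMatrix 1 a) (mulMatrix (-1) b) := by
  ext i j
  fin_cases i <;> fin_cases j <;>
    simp [mulMatrix_apply, Matrix.mul_apply, Fin.sum_univ_four] <;> ring

theorem det_mulMatrix (ε : ℤˣ) (a : ℍ[ℝ]) : (mulMatrix ε a).det = normSq a ^ 2 := by
  rcases Int.units_eq_one_or ε with rfl | rfl <;>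
    simp [mulMatrix_apply, Matrix.det_succ_row_zero, Fin.sum_univ_succ, normSq_def',
      Fin.succAbove] <;> ring

theorem mulMatrix_one_mulVec (a x : ℍ[ℝ]) :
    mulMatrix 1 a *ᵥ equivTuple ℝ x = equivTuple ℝ (a * x) := by
  ext i
  fin_cases i <;> simp [mulMatrix_apply, Matrix.mulVec, dotProduct, Fin.sum_univ_four] <;> ring

theorem mulMatrix_neg_one_mulVec (a x : ℍ[ℝ]) :
    mulMatrix (-1) a *ᵥ equivTuple ℝ x = equivTuple ℝ (x * star a) := by
  ext i
  fin_cases i <;> simp [mulMatrix_apply, Matrix.mulVec, dotProduct, Fin.sum_univ_four] <;> ring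

theorem continuous_mulMatrix (ε : ℤˣ) : Continuous (mulMatrix ε) :=
  (mulMatrix ε).continuous_of_finiteDimensional

/-- Unit quaternions act on `ℝ⁴ = ℍ` by multiplication from the left or from the right. -/
def mulRotation (ε : ℤˣ) : unitary ℍ[ℝ] →* specialOrthogonalGroup (Fin 4) ℝ where
  toFun a := ⟨mulMatrix ε a, by
    refine mem_specialOrthogonalGroup_iff.2 ⟨(mem_orthogonalGroup_iff _ _).2 ?_, ?_⟩
    · rw [← mulMatrix_star, ← mulMatrix_mul, Unitary.mul_star_self_of_mem a.2, mulMatrix_one]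
    · rw [det_mulMatrix, mem_unitary_iff_normSq_eq_one.1 a.2, one_pow]⟩
  map_one' := Subtype.ext (mulMatrix_one ε)
  map_mul' a b := Subtype.ext (mulMatrix_mul ε a b)

/-- The double cover of `SO(4)`: the pair `g` of unit quaternions acts on the quaternions by
`x ↦ g 1 * x * star (g (-1))`. -/
def spin : (ℤˣ → unitary ℍ[ℝ]) →* specialOrthogonalGroup (Fin 4) ℝ where
  toFun g := mulRotation 1 (g 1) * mulRotation (-1) (g (-1))
  map_one' := by simp
  map_mul' g h := by
    have hcomm : Commute (mulRotation 1 (h 1)) (mulRotation (-1) (g (-1))) :=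
      Subtype.ext (commute_mulMatrix _ _)
    simp only [Pi.mul_apply, map_mul, mul_assoc]
    rw [← mul_assoc (mulRotation 1 (h 1)), hcomm.eq, mul_assoc]

theorem coe_spin (g : ℤˣ → unitary ℍ[ℝ]) :
    (spin g : Matrix (Fin 4) (Fin 4) ℝ) = mulMatrix 1 (g 1) * mulMatrix (-1) (g (-1)) := rfl

theorem continuous_spin : Continuous spin := by
  refine continuous_induced_rng.2 (Continuous.mul ?_ ?_) <;>
    exact (continuous_mulMatrix _).comp (by fun_prop)

theorem exists_reflection_eq {u : ℍ[ℝ]} (hu : u ≠ 0) :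
    ∃ c d : unitary ℍ[ℝ], ∀ x, (ℝ ∙ u)ᗮ.reflection x = c * star x * star (d : ℍ[ℝ]) := by
  have hnorm : ‖u‖ ≠ 0 := norm_ne_zero_iff.2 hu
  have hmem : ‖u‖⁻¹ • u ∈ unitary ℍ[ℝ] := by
    rw [mem_unitary_iff_normSq_eq_one, normSq_smul, normSq_eq_norm_mul_self]
    field_simp
  let c : unitary ℍ[ℝ] := ⟨_, hmem⟩
  refine ⟨-c, star c, fun x => ?_⟩
  have h : u * star x * u = (2 * ⟪u, x⟫) • u - normSq u • x := by
    have h' : u * star x = ((2 * ⟪u, x⟫ : ℝ) : ℍ[ℝ]) - x * star u := by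
      rw [eq_sub_iff_add_eq, Quaternion.inner_def, ← self_add_star', star_mul, star_star]
    rw [h', sub_mul, coe_mul_eq_smul, mul_assoc, star_mul_self, ← coe_commutes, coe_mul_eq_smul]
  rw [Submodule.reflection_orthogonal_apply, Submodule.reflection_singleton_apply]
  change _ = -(‖u‖⁻¹ • u) * star x * star (star (‖u‖⁻¹ • u))
  rw [star_star, neg_mul, neg_mul, smul_mul_assoc, smul_mul_assoc, mul_smul_comm, h,
    normSq_eq_norm_mul_self, RCLike.ofReal_real_eq_id, id]
  match_scalars <;> field_simp

theorem exists_eq_mul_mul_or_eq_mul_star_mul (φ : ℍ[ℝ] ≃ₗᵢ[ℝ] ℍ[ℝ]) :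
    ∃ a b : unitary ℍ[ℝ], (∀ x, φ x = a * x * star (b : ℍ[ℝ])) ∨
      ∀ x, φ x = a * star x * star (b : ℍ[ℝ]) := by
  obtain ⟨l, -, rfl⟩ := φ.reflections_generate_dim
  induction l with
  | nil => exact ⟨1, 1, Or.inl fun x => by simp⟩
  | cons u l ih =>
    rw [List.map_cons, List.prod_cons]
    rcases eq_or_ne u 0 with rfl | hu
    · have h : (ℝ ∙ (0 : ℍ[ℝ]))ᗮ.reflection = 1 :=
        LinearIsometryEquiv.ext fun x => Submodule.reflection_mem_subspace_eq_self (by simp)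
      rwa [h, one_mul]
    · obtain ⟨c, d, hcd⟩ := exists_reflection_eq hu
      obtain ⟨a, b, hab⟩ := ih
      refine ⟨c * b, d * a, hab.symm.imp (fun h x => ?_) fun h x => ?_⟩ <;>
      · rw [LinearIsometryEquiv.coe_mul, Function.comp_apply, h, hcd]
        simp only [star_mul, star_star, Submonoid.coe_mul, mul_assoc]

theorem exists_linearIsometryEquiv_eq_mulVec {A : Matrix (Fin 4) (Fin 4) ℝ}
    (hA : A ∈ orthogonalGroup (Fin 4) ℝ) :
    ∃ φ : ℍ[ℝ] ≃ₗᵢ[ℝ] ℍ[ℝ], ∀ x, equivTuple ℝ (φ x) = A *ᵥ equivTuple ℝ x := by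
  let e := Quaternion.linearIsometryEquivTuple
  let A' : unitary (EuclideanSpace ℝ (Fin 4) →L[ℝ] EuclideanSpace ℝ (Fin 4)) :=
    ⟨toEuclideanCLM (𝕜 := ℝ) A, Unitary.map_mem (toEuclideanCLM (𝕜 := ℝ)) hA⟩
  refine ⟨e.trans ((Unitary.linearIsometryEquiv A').trans e.symm), fun x => ?_⟩
  exact congrArg WithLp.ofLp (e.apply_symm_apply (toEuclideanCLM (𝕜 := ℝ) A (e x)))

theorem ext_mulVec_equivTuple {A B : Matrix (Fin 4) (Fin 4) ℝ}
    (h : ∀ x, A *ᵥ equivTuple ℝ x = B *ᵥ equivTuple ℝ x) : A = B :=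
  ext_of_mulVec_single fun i => by
    obtain ⟨x, hx⟩ := (equivTuple ℝ).surjective (Pi.single i (1 : ℝ))
    rw [← hx, h]

theorem spin_mulVec (g : ℤˣ → unitary ℍ[ℝ]) (x : ℍ[ℝ]) :
    (spin g : Matrix (Fin 4) (Fin 4) ℝ) *ᵥ equivTuple ℝ x =
      equivTuple ℝ (g 1 * x * star (g (-1) : ℍ[ℝ])) := by
  rw [coe_spin, ← mulVec_mulVec, mulMatrix_neg_one_mulVec, mulMatrix_one_mulVec, mul_assoc]

theorem spin_surjective : Function.Surjective spin := by
  intro A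
  obtain ⟨hA, hdet⟩ := mem_specialOrthogonalGroup_iff.1 A.2
  obtain ⟨φ, hφ⟩ := exists_linearIsometryEquiv_eq_mulVec hA
  obtain ⟨a, b, hφ'⟩ := exists_eq_mul_mul_or_eq_mul_star_mul φ
  let g : ℤˣ → unitary ℍ[ℝ] := fun ε => if ε = 1 then a else b
  have hg1 : g 1 = a := if_pos rfl
  have hg2 : g (-1) = b := if_neg (by decide)
  rcases hφ' with h | h
  · refine ⟨g, Subtype.ext (ext_mulVec_equivTuple fun x => ?_)⟩
    rw [spin_mulVec, ← hφ, h, hg1, hg2]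
  · let S : Matrix (Fin 4) (Fin 4) ℝ := diagonal ![1, -1, -1, -1]
    have hS : ∀ x, S *ᵥ equivTuple ℝ x = equivTuple ℝ (star x) := by
      intro x
      ext i
      fin_cases i <;> simp [S, mulVec_diagonal]
    have hdetS : S.det = -1 := by simp [S, Fin.prod_univ_four]
    have hAS : A.1 = (spin g).1 * S := ext_mulVec_equivTuple fun x => by
      rw [← mulVec_mulVec, hS, spin_mulVec, ← hφ, h, hg1, hg2]
    rw [hAS, det_mul, (mem_specialOrthogonalGroup_iff.1 (spin g).2).2, hdetS] at hdet
    norm_num at hdet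

theorem commute_mulMatrix_neg (ε : ℤˣ) (a b : ℍ[ℝ]) :
    Commute (mulMatrix ε a) (mulMatrix (-ε) b) := by
  rcases Int.units_eq_one_or ε with rfl | rfl
  · exact commute_mulMatrix a b
  · rw [neg_neg]
    exact (commute_mulMatrix b a).symm

theorem coe_spin_eq_mul_neg (ε : ℤˣ) (g : ℤˣ → unitary ℍ[ℝ]) :
    (spin g : Matrix (Fin 4) (Fin 4) ℝ) = mulMatrix ε (g ε) * mulMatrix (-ε) (g (-ε)) := by
  rcases Int.units_eq_one_or ε with rfl | rfl
  · exact coe_spin g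
  · rw [(commute_mulMatrix_neg _ _ _).eq, neg_neg, coe_spin]

theorem spin_mul_mulMatrix_mul_transpose (g : ℤˣ → unitary ℍ[ℝ]) (ε : ℤˣ) (x : ℍ[ℝ]) :
    (spin g : Matrix (Fin 4) (Fin 4) ℝ) * mulMatrix ε x * (spin g : Matrix (Fin 4) (Fin 4) ℝ)ᵀ =
      mulMatrix ε (g ε * x * star (g ε : ℍ[ℝ])) := by
  have hcancel : mulMatrix (-ε) (g (-ε)) * mulMatrix (-ε) (star (g (-ε) : ℍ[ℝ])) = 1 := by
    rw [← mulMatrix_mul, Unitary.mul_star_self_of_mem (g (-ε)).2, mulMatrix_one]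
  rw [coe_spin_eq_mul_neg ε, transpose_mul, ← mulMatrix_star, ← mulMatrix_star]
  calc _ = mulMatrix ε (g ε) * (mulMatrix (-ε) (g (-ε)) * mulMatrix ε x) *
        mulMatrix (-ε) (star (g (-ε) : ℍ[ℝ])) * mulMatrix ε (star (g ε : ℍ[ℝ])) := by
        simp only [mul_assoc]
    _ = mulMatrix ε (g ε) * mulMatrix ε x *
        (mulMatrix (-ε) (g (-ε)) * mulMatrix (-ε) (star (g (-ε) : ℍ[ℝ]))) *
          mulMatrix ε (star (g ε : ℍ[ℝ])) := by
        rw [← (commute_mulMatrix_neg ε _ _).eq]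
        simp only [mul_assoc]
    _ = _ := by rw [hcancel, mul_one, mulMatrix_mul, mulMatrix_mul]

/-! ### Rotations and their axes -/

section Rotation

variable {C D : specialOrthogonalGroup (Fin 3) ℝ} {θ η : ℝ} {p p' : EuclideanSpace ℝ (Fin 3)}

theorem specialOrthogonal_mul_transpose {n : Type*} [Fintype n] [DecidableEq n]
    (A : specialOrthogonalGroup n ℝ) : A.1 * A.1ᵀ = 1 :=
  (mem_orthogonalGroup_iff _ _).1 (mem_specialOrthogonalGroup_iff.1 A.2).1

theorem specialOrthogonal_transpose_mul {n : Type*} [Fintype n] [DecidableEq n]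
    (A : specialOrthogonalGroup n ℝ) : A.1ᵀ * A.1 = 1 :=
  mul_eq_one_comm.1 (specialOrthogonal_mul_transpose A)

theorem rotMatrix_zero : rotMatrix 0 = 1 := by
  ext i j
  fin_cases i <;> fin_cases j <;> simp [rotMatrix]

theorem rotMatrix_add (θ η : ℝ) : rotMatrix (θ + η) = rotMatrix θ * rotMatrix η := by
  ext i j
  fin_cases i <;> fin_cases j <;>
    simp [rotMatrix, Matrix.mul_apply, Fin.sum_univ_three, Real.cos_add, Real.sin_add] <;> ring

theorem rotMatrix_eq_one_iff : rotMatrix θ = 1 ↔ Real.cos θ = 1 := by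
  refine ⟨fun h => by simpa [rotMatrix] using congrFun (congrFun h 1) 1, fun h => ?_⟩
  have hsin : Real.sin θ = 0 := Real.sin_eq_zero_iff_cos_eq.2 (Or.inl h)
  ext i j
  fin_cases i <;> fin_cases j <;> simp [rotMatrix, h, hsin]

theorem mul_rotMatrix_mul_transpose_pow {V : Matrix (Fin 3) (Fin 3) ℝ} (hV : Vᵀ * V = 1) (θ : ℝ)
    (n : ℕ) : (V * rotMatrix θ * Vᵀ) ^ n = V * rotMatrix (n * θ) * Vᵀ := by
  induction n with
  | zero => simp [rotMatrix_zero, mul_eq_one_comm.1 hV]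
  | succ n ih =>
    calc _ = V * rotMatrix (n * θ) * (Vᵀ * V) * rotMatrix θ * Vᵀ := by
          rw [pow_succ, ih]
          simp only [mul_assoc]
      _ = _ := by rw [hV, mul_one, mul_assoc V, ← rotMatrix_add, Nat.cast_succ, add_one_mul]

theorem IsRotation.pow (h : IsRotation C θ p) (n : ℕ) : IsRotation (C ^ n) (n * θ) p := by
  obtain ⟨V, hC, hp⟩ := h
  refine ⟨V, ?_, hp⟩
  rw [SubmonoidClass.coe_pow, hC,
    mul_rotMatrix_mul_transpose_pow (specialOrthogonal_transpose_mul V)]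

theorem IsRotation.eq_one_iff (h : IsRotation C θ p) : C = 1 ↔ Real.cos θ = 1 := by
  obtain ⟨V, hC, -⟩ := h
  have hV := specialOrthogonal_transpose_mul V
  rw [← rotMatrix_eq_one_iff, ← Subtype.val_inj, hC]
  constructor <;> intro h
  · calc rotMatrix θ = V.1ᵀ * V.1 * rotMatrix θ * (V.1ᵀ * V.1) := by rw [hV, one_mul, mul_one]
      _ = V.1ᵀ * (V.1 * rotMatrix θ * V.1ᵀ) * V.1 := by simp only [mul_assoc]
      _ = 1 := by rw [h, OneMemClass.coe_one, mul_one, hV]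
  · rw [h, mul_one, specialOrthogonal_mul_transpose, OneMemClass.coe_one]

theorem IsRotation.isOfFinOrder_iff (h : IsRotation C θ p) :
    IsOfFinOrder C ↔ ¬ Irrational (θ / π) := by
  rw [isOfFinOrder_iff_pow_eq_one, Irrational, not_not]
  constructor
  · rintro ⟨n, hn, hCn⟩
    obtain ⟨k, hk⟩ := (Real.cos_eq_one_iff _).1 ((h.pow n).eq_one_iff.1 hCn)
    refine ⟨k * 2 / n, ?_⟩
    push_cast
    field_simp
    linarith
  · rintro ⟨q, hq⟩
    have hnum : (q : ℝ) * q.den = q.num := mod_cast q.mul_den_eq_num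
    refine ⟨2 * q.den, by positivity, (h.pow _).eq_one_iff.2 ?_⟩
    refine (Real.cos_eq_one_iff _).2 ⟨q.num, ?_⟩
    rw [← div_mul_cancel₀ θ Real.pi_ne_zero, ← hq]
    push_cast
    linear_combination (-2 * π) * hnum

theorem IsRotation.mulVec_axis (h : IsRotation C θ p) : C.1 *ᵥ p.ofLp = p := by
  obtain ⟨V, hC, hp⟩ := h
  have hp' : p.ofLp = V.1 *ᵥ Pi.single 0 1 := funext fun i => by simp [hp]
  have hfix : rotMatrix θ *ᵥ Pi.single 0 1 = Pi.single 0 1 := by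
    ext i
    fin_cases i <;> simp [rotMatrix]
  rw [hC, hp', mulVec_mulVec, mul_assoc, specialOrthogonal_transpose_mul, mul_one,
    ← mulVec_mulVec, hfix]

theorem IsRotation.axis_ne_zero (h : IsRotation C θ p) : p ≠ 0 := by
  obtain ⟨V, -, hp⟩ := h
  rintro rfl
  have hV : (V.1ᵀ * V.1) 0 0 = 1 := by rw [specialOrthogonal_transpose_mul, one_apply_eq]
  simp [Matrix.mul_apply, ← hp] at hV

theorem exists_eq_smul_single_of_rotMatrix_mulVec (hθ : Real.sin θ ≠ 0) {y : Fin 3 → ℝ} {r : ℝ}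
    (hy : rotMatrix θ *ᵥ y = r • y) : y = y 0 • Pi.single 0 1 := by
  have h₁ : Real.cos θ * y 1 - Real.sin θ * y 2 = r * y 1 := by
    simpa [rotMatrix, mulVec, dotProduct, Fin.sum_univ_three, sub_eq_add_neg] using congrFun hy 1
  have h₂ : Real.sin θ * y 1 + Real.cos θ * y 2 = r * y 2 := by
    simpa [rotMatrix, mulVec, dotProduct, Fin.sum_univ_three] using congrFun hy 2
  have h : Real.sin θ * (y 1 ^ 2 + y 2 ^ 2) = 0 := by linear_combination y 1 * h₂ - y 2 * h₁
  have h' := (mul_eq_zero.1 h).resolve_left hθ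
  have hy₁ : y 1 = 0 := by nlinarith [sq_nonneg (y 1), sq_nonneg (y 2)]
  have hy₂ : y 2 = 0 := by nlinarith [sq_nonneg (y 1), sq_nonneg (y 2)]
  ext i
  fin_cases i <;> simp [hy₁, hy₂]

theorem IsRotation.exists_eq_smul_axis (h : IsRotation C θ p) (hθ : Real.sin θ ≠ 0)
    {x : Fin 3 → ℝ} {r : ℝ} (hx : C.1 *ᵥ x = r • x) : ∃ s : ℝ, x = s • p.ofLp := by
  obtain ⟨V, hC, hp⟩ := h
  have hp' : p.ofLp = V.1 *ᵥ Pi.single 0 1 := funext fun i => by simp [hp]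
  have hy : rotMatrix θ *ᵥ (V.1ᵀ *ᵥ x) = r • V.1ᵀ *ᵥ x := by
    rw [← mulVec_smul, ← hx, hC, mulVec_mulVec, mulVec_mulVec, ← mul_assoc, ← mul_assoc,
      specialOrthogonal_transpose_mul, one_mul]
  refine ⟨(V.1ᵀ *ᵥ x) 0, ?_⟩
  rw [hp', ← mulVec_smul, ← exists_eq_smul_single_of_rotMatrix_mulVec hθ hy, mulVec_mulVec,
    specialOrthogonal_mul_transpose, one_mulVec]

theorem IsRotation.conj (h : IsRotation C θ p) (D : specialOrthogonalGroup (Fin 3) ℝ) :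
    IsRotation (D * C * D⁻¹) θ (WithLp.toLp 2 (D.1 *ᵥ p.ofLp)) := by
  obtain ⟨V, hC, hp⟩ := h
  refine ⟨D * V, ?_, fun i => ?_⟩
  · change D.1 * C.1 * D.1ᵀ = D.1 * V.1 * rotMatrix θ * (D.1 * V.1)ᵀ
    rw [hC, transpose_mul]
    simp only [mul_assoc]
  · change (D.1 *ᵥ p.ofLp) i = (D.1 * V.1) i 0
    simp [mulVec, dotProduct, Matrix.mul_apply, hp]

theorem IsRotation.not_commute_conj (hC : IsRotation C θ p) (hD : IsRotation D η p')
    (hθ : Real.sin θ ≠ 0) (hη : Real.sin η ≠ 0)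
    (hangle : InnerProductGeometry.angle p p' ∈ Set.Ioo 0 π) : ¬ Commute C (D * C * D⁻¹) := by
  -- A rotation commuting with `C` preserves the axis of `C`, so `D` preserves it as well.
  intro hcomm
  have hE := hC.conj D
  have hfix : (D * C * D⁻¹).1 *ᵥ (C.1 *ᵥ (D.1 *ᵥ p.ofLp)) =
      (1 : ℝ) • C.1 *ᵥ (D.1 *ᵥ p.ofLp) := by
    have h : (D * C * D⁻¹).1 * C.1 = C.1 * (D * C * D⁻¹).1 := congrArg Subtype.val hcomm.eq.symm
    rw [mulVec_mulVec, h, ← mulVec_mulVec, hE.mulVec_axis, one_smul]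
  obtain ⟨r, hr⟩ := hE.exists_eq_smul_axis hθ hfix
  obtain ⟨s, hs⟩ := hC.exists_eq_smul_axis hθ hr
  obtain ⟨t, ht⟩ := hD.exists_eq_smul_axis hη hs
  have hp : p = t • p' := congrArg (WithLp.toLp 2) ht
  rcases lt_trichotomy t 0 with ht | rfl | ht
  · rw [hp, InnerProductGeometry.angle_smul_left_of_neg _ _ ht,
      InnerProductGeometry.angle_neg_self_of_nonzero hD.axis_ne_zero] at hangle
    exact hangle.2.ne rfl
  · exact hC.axis_ne_zero (hp.trans (zero_smul _ _))
  · rw [hp, InnerProductGeometry.angle_smul_left_of_pos _ _ ht,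
      InnerProductGeometry.angle_self hD.axis_ne_zero] at hangle
    exact hangle.1.ne rfl

end Rotation

/-! ### Bivectors and the adjoint action -/

section Bivector

variable {V : Type*} [NormedAddCommGroup V] [InnerProductSpace ℝ V]

theorem wedge_sum_smul_sum_smul {ι : Type*} [Fintype ι] (x y : ι → ℝ) (e : ι → V) :
    wedge (∑ a, x a • e a) (∑ b, y b • e b) = ∑ a, ∑ b, (x a * y b) • wedge (e a) (e b) := by
  let L : MultilinearMap ℝ (fun _ : Fin 2 => V) (⋀[ℝ]^2 V) :=
    (exteriorPower.ιMulti ℝ 2).toMultilinearMap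
  have hleft (z : V) : wedge (∑ a, x a • e a) z = ∑ a, x a • wedge (e a) z := by
    have h (u : V) : L.toLinearMap ![0, z] 0 u = wedge u z :=
      congrArg L (List.ofFn_injective rfl)
    simp only [← h, map_sum, map_smul]
  have hright (z : V) : wedge z (∑ b, y b • e b) = ∑ b, y b • wedge z (e b) := by
    have h (u : V) : L.toLinearMap ![z, 0] 1 u = wedge z u :=
      congrArg L (List.ofFn_injective rfl)
    simp only [← h, map_sum, map_smul]
  simp only [hleft, hright, Finset.smul_sum, smul_smul]

variable [FiniteDimensional ℝ V]

theorem inner_wedge_wedge (a b c d : V) :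
    ⟪wedge a b, wedge c d⟫ = ⟪a, c⟫ * ⟪b, d⟫ - ⟪a, d⟫ * ⟪b, c⟫ := by
  rw [wedge, wedge, exteriorPower.inner_ιMulti_ιMulti, det_fin_two]
  simp only [of_apply, cons_val_zero, cons_val_one]
  ring

/-- The skew matrix of the inner products of a bivector with the bivectors `vᵢ ∧ vⱼ`. In a
positively oriented orthonormal basis, the (anti-)self-dual bivectors become the left or right
multiplications by pure quaternions. -/
def bivectorMatrix {n : Type*} (v : n → V) : ⋀[ℝ]^2 V →ₗ[ℝ] Matrix n n ℝ where
  toFun w := Matrix.of fun i j => ⟪w, wedge (v i) (v j)⟫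
  map_add' w w' := by ext i j; simp [inner_add_left]
  map_smul' r w := by ext i j; simp [real_inner_smul_left]

theorem bivectorMatrix_apply {n : Type*} (v : n → V) (w : ⋀[ℝ]^2 V) (i j : n) :
    bivectorMatrix v w i j = ⟪w, wedge (v i) (v j)⟫ := rfl

theorem bivectorMatrix_sum_smul {n : Type*} [Fintype n] (B : Matrix n n ℝ) (e : n → V)
    (w : ⋀[ℝ]^2 V) :
    bivectorMatrix (fun i => ∑ a, B i a • e a) w = B * bivectorMatrix e w * Bᵀ := by
  ext i j
  simp only [bivectorMatrix_apply, wedge_sum_smul_sum_smul, inner_sum, real_inner_smul_right,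
    Matrix.mul_apply, transpose_apply, Finset.sum_mul]
  rw [Finset.sum_comm]
  exact Finset.sum_congr rfl fun a _ => Finset.sum_congr rfl fun b _ => by ring

theorem bivectorMatrix_injective {n : Type*} [LinearOrder n] [Fintype n]
    (v : OrthonormalBasis n ℝ V) : Function.Injective (bivectorMatrix v) := by
  rw [injective_iff_map_eq_zero]
  intro w hw
  have h : innerₗ (⋀[ℝ]^2 V) w = 0 := by
    refine (v.toBasis.exteriorPower 2).ext fun s => ?_
    rw [exteriorPower.basis_apply, exteriorPower.ιMulti_family]
    have hs := congrFun (congrFun hw (Set.powersetCard.ofFinEmbEquiv.symm s 0))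
      (Set.powersetCard.ofFinEmbEquiv.symm s 1)
    rw [bivectorMatrix_apply] at hs
    rw [LinearMap.zero_apply, innerₗ_apply_apply]
    refine Eq.trans (congrArg _ (congrArg _ (funext fun i => ?_))) hs
    fin_cases i <;> simp
  exact inner_self_eq_zero.1 (congrArg (fun L => L w) h)

theorem bivectorMatrix_wedge {n : Type*} [Fintype n] [DecidableEq n] (e : OrthonormalBasis n ℝ V)
    (a b i j : n) :
    bivectorMatrix e (wedge (e a) (e b)) i j =
      (if a = i then 1 else 0) * (if b = j then 1 else 0) -
        (if a = j then 1 else 0) * (if b = i then 1 else 0) := by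
  simp only [bivectorMatrix_apply, inner_wedge_wedge, e.inner_eq_ite]

theorem bivectorMatrix_twistorFrame (ε : ℤˣ) (e : OrthonormalBasis (Fin 4) ℝ V) (k : Fin 3) :
    bivectorMatrix e (twistorFrame ε e k) =
      mulMatrix ε (![⟨0, -(ε : ℤ) / √2, 0, 0⟩, ⟨0, 0, -(ε : ℤ) / √2, 0⟩,
        ⟨0, 0, 0, -(ε : ℤ) / √2⟩] k) := by
  rw [mulMatrix_apply]
  rcases Int.units_eq_one_or ε with rfl | rfl <;> ext i j <;> fin_cases k <;> fin_cases i <;>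
    fin_cases j <;> simp [twistorFrame, bivectorMatrix_wedge, neg_div]

theorem selfDual_le_comap_bivectorMatrix {o : Orientation ℝ V (Fin 4)}
    {v : OrthonormalBasis (Fin 4) ℝ V} (hv : v.toBasis.orientation = o) (ε : ℤˣ) :
    selfDual o ε ≤ (LinearMap.range (mulMatrix ε)).comap (bivectorMatrix v) := by
  rw [selfDual, Submodule.span_le]
  rintro - ⟨e, he, k, rfl⟩
  set B : Matrix (Fin 4) (Fin 4) ℝ := (e.toBasis.toMatrix v)ᵀ with hB
  have hmem : B ∈ specialOrthogonalGroup (Fin 4) ℝ := by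
    refine mem_specialOrthogonalGroup_iff.2 ⟨(mem_orthogonalGroup_iff' _ _).2 ?_, ?_⟩
    · rw [hB, transpose_transpose]
      exact e.toMatrix_orthonormalBasis_self_mul_conjTranspose v
    · rw [det_transpose]
      exact e.det_to_matrix_orthonormalBasis_of_same_orientation v (he.trans hv.symm)
  obtain ⟨g, hg⟩ := spin_surjective ⟨B, hmem⟩
  have hve : ⇑v = fun i => ∑ a, B i a • e a := funext fun i => by
    simpa [hB] using (e.toBasis.sum_toMatrix_smul_self v i).symm
  have hgB : (spin g : Matrix (Fin 4) (Fin 4) ℝ) = B := congrArg Subtype.val hg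
  rw [SetLike.mem_coe, Submodule.mem_comap, hve, bivectorMatrix_sum_smul,
    bivectorMatrix_twistorFrame, ← hgB, spin_mul_mulMatrix_mul_transpose]
  exact LinearMap.mem_range_self _ _

theorem exists_injective_bivectorMatrix_eq {ι : Type*} [Fintype ι] {o : Orientation ℝ V (Fin 4)}
    {v : OrthonormalBasis (Fin 4) ℝ V} (hv : v.toBasis.orientation = o) {ε : ℤˣ}
    {w : ι → ⋀[ℝ]^2 V} (hmem : ∀ k, w k ∈ selfDual o ε) (hw : LinearIndependent ℝ w) :
    ∃ Φ : (ι → ℝ) →ₗ[ℝ] ℍ[ℝ], Function.Injective Φ ∧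
      ∀ x, mulMatrix ε (Φ x) = bivectorMatrix v (∑ k, x k • w k) := by
  choose n hn using fun k => selfDual_le_comap_bivectorMatrix hv ε (hmem k)
  have hΦ : ∀ x, mulMatrix ε (Fintype.linearCombination ℝ n x) =
      bivectorMatrix v (Fintype.linearCombination ℝ w x) := fun x => by
    simp only [Fintype.linearCombination_apply, map_sum, map_smul, hn]
  refine ⟨Fintype.linearCombination ℝ n, fun x y hxy => ?_, hΦ⟩
  refine hw.fintypeLinearCombination_injective (bivectorMatrix_injective v ?_)
  rw [← hΦ, ← hΦ, hxy]

end Bivector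

section Adjoint

theorem sq_eq_one_of_forall_commute {S : Submodule ℝ ℍ[ℝ]} (hS : 2 < Module.finrank ℝ S)
    {x : unitary ℍ[ℝ]} (h : ∀ y ∈ S, Commute (x : ℍ[ℝ]) y) : x ^ 2 = 1 := by
  obtain ⟨w, z, rfl⟩ := exists_circleHom_eq x
  by_cases him : (z : ℂ).im = 0
  · have hre : (z : ℂ).re ^ 2 = 1 := by
      simpa [Complex.normSq_apply, him, sq] using Circle.normSq_coe z
    ext1
    rw [SubmonoidClass.coe_pow, coe_circleHom, him, zero_smul, add_zero, smul_pow, hre, one_pow,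
      one_smul, OneMemClass.coe_one]
  · have hle : S ≤ LinearMap.range (Complex.lift w).toLinearMap := fun y hy => by
      have hyw : Commute y ((z : ℂ).im • (w : ℍ[ℝ])) := by
        rw [eq_sub_of_add_eq' (coe_circleHom w z).symm]
        exact (h y hy).symm.sub_right ((Commute.one_right y).smul_right _)
      obtain ⟨r, s, rfl⟩ :=
        exists_eq_smul_one_add_smul_of_commute ((Commute.smul_right_iff₀ him).1 hyw)
      exact ⟨⟨r, s⟩, by rw [← Algebra.algebraMap_eq_smul_one]; rfl⟩
    have hrank := (Submodule.finrank_mono hle).trans (LinearMap.finrank_range_le _)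
    rw [Complex.finrank_real_complex] at hrank
    omega

/-- The graph of the adjoint action of unit quaternions on the three-dimensional space `range Φ` of
quaternions: the pairs `(a, C)` such that conjugation by `a` acts on `range Φ` by the matrix `C`. -/
def adjointPairs (Φ : (Fin 3 → ℝ) →ₗ[ℝ] ℍ[ℝ]) :
    Subgroup (unitary ℍ[ℝ] × specialOrthogonalGroup (Fin 3) ℝ) where
  carrier := {g | ∀ x, g.1 * Φ x * star (g.1 : ℍ[ℝ]) = Φ (g.2.1 *ᵥ x)}
  one_mem' := by simp
  mul_mem' {g h} hg hh x := by
    calc (g.1 * h.1 * Φ x * star (g.1 * h.1 : ℍ[ℝ]) : ℍ[ℝ])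
        = g.1 * (h.1 * Φ x * star (h.1 : ℍ[ℝ])) * star (g.1 : ℍ[ℝ]) := by
          simp only [star_mul, mul_assoc]
      _ = Φ (g.2.1 *ᵥ (h.2.1 *ᵥ x)) := by rw [hh x, hg]
      _ = Φ ((g.2.1 * h.2.1) *ᵥ x) := by rw [mulVec_mulVec]
  inv_mem' {g} hg x := by
    have hfst : star (g.1 : ℍ[ℝ]) * g.1 = 1 := Unitary.star_mul_self_of_mem g.1.2
    have hsnd : g.2.1 *ᵥ (g.2.1ᵀ *ᵥ x) = x := by
      rw [mulVec_mulVec, specialOrthogonal_mul_transpose, one_mulVec]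
    calc (star (g.1 : ℍ[ℝ]) * Φ x * star (star (g.1 : ℍ[ℝ])) : ℍ[ℝ])
        = star (g.1 : ℍ[ℝ]) * (g.1 * Φ (g.2.1ᵀ *ᵥ x) * star (g.1 : ℍ[ℝ])) * g.1 := by
          rw [hg, hsnd, star_star]
      _ = star (g.1 : ℍ[ℝ]) * g.1 * Φ (g.2.1ᵀ *ᵥ x) * (star (g.1 : ℍ[ℝ]) * g.1) := by
          simp only [mul_assoc]
      _ = Φ (g.2.1ᵀ *ᵥ x) := by rw [hfst, one_mul, mul_one]

variable {Φ : (Fin 3 → ℝ) →ₗ[ℝ] ℍ[ℝ]} {a b : unitary ℍ[ℝ]}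
  {C D : specialOrthogonalGroup (Fin 3) ℝ}

theorem mem_adjointPairs_of_single
    (h : ∀ k, (a * Φ (Pi.single k 1) * star (a : ℍ[ℝ]) : ℍ[ℝ]) = Φ (C.1.col k)) :
    (a, C) ∈ adjointPairs Φ := by
  have hlin : LinearMap.mulRight ℝ (star (a : ℍ[ℝ])) ∘ₗ LinearMap.mulLeft ℝ (a : ℍ[ℝ]) ∘ₗ Φ =
      Φ ∘ₗ C.1.mulVecLin :=
    LinearMap.pi_ext' fun k => LinearMap.ext_ring (by simpa using h k)
  exact fun x => LinearMap.congr_fun hlin x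

theorem eq_of_mem_adjointPairs (hΦ : Function.Injective Φ) (hC : (a, C) ∈ adjointPairs Φ)
    (hD : (a, D) ∈ adjointPairs Φ) : C = D :=
  Subtype.ext (ext_of_mulVec_single fun _ => hΦ ((hC _).symm.trans (hD _)))

theorem commute_of_mem_adjointPairs (hΦ : Function.Injective Φ) (hC : (a, C) ∈ adjointPairs Φ)
    (hD : (b, D) ∈ adjointPairs Φ) (h : Commute a b) : Commute C D :=
  eq_of_mem_adjointPairs hΦ (mul_mem hC hD) (by
    have := mul_mem hD hC
    rwa [Prod.mk_mul_mk, ← h.eq] at this)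

theorem not_commute_conj_of_mem_adjointPairs (hΦ : Function.Injective Φ)
    (hC : (a, C) ∈ adjointPairs Φ) (hD : (b, D) ∈ adjointPairs Φ)
    (h : ¬ Commute C (D * C * D⁻¹)) : ¬ Commute a (b * a * b⁻¹) := by
  have hconj : (b * a * b⁻¹, D * C * D⁻¹) ∈ adjointPairs Φ := by
    simpa only [Prod.mk_mul_mk, Prod.inv_mk] using mul_mem (mul_mem hD hC) (inv_mem hD)
  exact mt (commute_of_mem_adjointPairs hΦ hC hconj) h

theorem isOfFinOrder_iff_of_mem_adjointPairs (hΦ : Function.Injective Φ)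
    (h : (a, C) ∈ adjointPairs Φ) : IsOfFinOrder a ↔ IsOfFinOrder C := by
  simp only [isOfFinOrder_iff_pow_eq_one]
  constructor
  · rintro ⟨n, hn, ha⟩
    have hpow := pow_mem h n
    rw [Prod.pow_mk, ha] at hpow
    exact ⟨n, hn, eq_of_mem_adjointPairs hΦ hpow (one_mem _)⟩
  · rintro ⟨n, hn, hC⟩
    have hpow := pow_mem h n
    rw [Prod.pow_mk, hC] at hpow
    refine ⟨n * 2, by positivity, ?_⟩
    rw [pow_mul]
    refine sq_eq_one_of_forall_commute (S := LinearMap.range Φ) ?_ ?_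
    · rw [LinearMap.finrank_range_of_inj hΦ]
      simp
    · rintro - ⟨x, rfl⟩
      have hcancel := Unitary.star_mul_self_of_mem (a ^ n).2
      have hfix : ((a ^ n : unitary ℍ[ℝ]) * Φ x * star ((a ^ n : unitary ℍ[ℝ]) : ℍ[ℝ]) : ℍ[ℝ]) =
          Φ x := (hpow x).trans (congrArg Φ (one_mulVec x))
      change _ * _ = _ * _
      nth_rewrite 2 [← hfix]
      rw [mul_assoc _ (star _), hcancel, mul_one]

end Adjoint

/-! ### Monodromy -/

section Parallel

variable {E : Torus → Type*} [TopologicalSpace (Bundle.TotalSpace R4 E)]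
  [∀ b, NormedAddCommGroup (E b)] [∀ b, InnerProductSpace ℝ (E b)]
  [FiberBundle R4 E] [VectorBundle ℝ R4 E] [ContMDiffVectorBundle 1 R4 E IT]
  [IsContMDiffRiemannianBundle IT 1 R4 E]
  {nabla : CovariantDerivative IT R4 E} {c : ℝ → Torus} {t : ℝ}

theorem hasDerivAt_inner_section (hmetric : nabla.IsMetricCompatible)
    (hc : MDifferentiableAt 𝓘(ℝ, ℝ) IT c t) {s r : ∀ b, E b}
    (hs : MDifferentiableAt IT (IT.prod 𝓘(ℝ, R4))
      (fun b => Bundle.TotalSpace.mk' R4 b (s b)) (c t))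
    (hr : MDifferentiableAt IT (IT.prod 𝓘(ℝ, R4))
      (fun b => Bundle.TotalSpace.mk' R4 b (r b)) (c t)) :
    HasDerivAt (fun τ => ⟪s (c τ), r (c τ)⟫)
      (⟪nabla s (c t) (velocity c t), r (c t)⟫ + ⟪s (c t), nabla r (c t) (velocity c t)⟫) t := by
  have hinner := MDifferentiableAt.inner_bundle (b := id) hs hr
  have hd : DifferentiableAt ℝ (fun τ => ⟪s (c τ), r (c τ)⟫) t :=
    (hinner.comp t hc).differentiableAt
  refine hd.hasDerivAt.congr_deriv ?_
  rw [← hmetric.mvfderiv_inner_eq (fun _ => velocity c t) hs hr]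
  refine Eq.trans ?_ (mvfderiv_comp_apply t hinner hc (1 : ℝ))
  rw [← fderiv_apply_one_eq_deriv]
  simp only [mvfderiv, mfderiv_eq_fderiv]
  rfl

theorem HasCovDerivAlongAt.hasDerivAt_inner (hmetric : nabla.IsMetricCompatible)
    (hc : MDifferentiableAt 𝓘(ℝ, ℝ) IT c t) {ξ η : ∀ t, E (c t)} {v w : E (c t)}
    (hξ : HasCovDerivAlongAt nabla c ξ t v) (hη : HasCovDerivAlongAt nabla c η t w) :
    HasDerivAt (fun τ => ⟪ξ τ, η τ⟫) (⟪v, η t⟫ + ⟪ξ t, w⟫) t := by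
  obtain ⟨n, f, s, hf, hs, hξs, rfl⟩ := hξ
  obtain ⟨m, g, r, hg, hr, hηr, rfl⟩ := hη
  have hsum := HasDerivAt.fun_sum (u := Finset.univ) fun i _ =>
    HasDerivAt.fun_sum (u := Finset.univ) fun j _ =>
      ((hf i).hasDerivAt.mul (hg j).hasDerivAt).mul (hasDerivAt_inner_section hmetric hc
        ((hs i).mdifferentiableAt (by simp)) ((hr j).mdifferentiableAt (by simp)))
  refine (hsum.congr_of_eventuallyEq ?_).congr_deriv ?_
  · filter_upwards [hξs, hηr] with τ hξτ hητ
    rw [hξτ, hητ, sum_inner]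
    simp only [inner_sum, real_inner_smul_left, real_inner_smul_right, Pi.mul_apply]
    exact Finset.sum_congr rfl fun i _ => Finset.sum_congr rfl fun j _ => by ring
  · rw [hξs.self_of_nhds, hηr.self_of_nhds, sum_inner, sum_inner, ← Finset.sum_add_distrib]
    refine Finset.sum_congr rfl fun i _ => ?_
    rw [inner_sum, inner_sum, ← Finset.sum_add_distrib]
    refine Finset.sum_congr rfl fun j _ => ?_
    simp only [inner_add_left, inner_add_right, real_inner_smul_left, real_inner_smul_right,
      Pi.mul_apply]
    ring

variable [∀ b, FiniteDimensional ℝ (E b)] {Ω : ∀ t, ⋀[ℝ]^2 (E (c t))} {ξ η : ∀ t, E (c t)}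

theorem HasCovDerivAlongAt₂.hasDerivAt_inner_wedge (hmetric : nabla.IsMetricCompatible)
    (hc : MDifferentiableAt 𝓘(ℝ, ℝ) IT c t) {σ : ⋀[ℝ]^2 (E (c t))}
    (hΩ : HasCovDerivAlongAt₂ nabla c Ω t σ) (hξ : HasCovDerivAlongAt nabla c ξ t 0)
    (hη : HasCovDerivAlongAt nabla c η t 0) :
    HasDerivAt (fun τ => ⟪Ω τ, wedge (ξ τ) (η τ)⟫) ⟪σ, wedge (ξ t) (η t)⟫ t := by
  obtain ⟨n, a, b, a', b', ha, hb, hab, rfl⟩ := hΩ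
  have hsum := HasDerivAt.fun_sum (u := Finset.univ) fun k _ =>
    (((ha k).hasDerivAt_inner hmetric hc hξ).mul ((hb k).hasDerivAt_inner hmetric hc hη)).sub
      (((ha k).hasDerivAt_inner hmetric hc hη).mul ((hb k).hasDerivAt_inner hmetric hc hξ))
  refine (hsum.congr_of_eventuallyEq ?_).congr_deriv ?_
  · filter_upwards [hab] with τ h
    rw [h, sum_inner]
    exact Finset.sum_congr rfl fun k _ => inner_wedge_wedge _ _ _ _
  · rw [sum_inner]
    refine Finset.sum_congr rfl fun k _ => ?_
    rw [inner_add_left, inner_wedge_wedge, inner_wedge_wedge]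
    simp only [inner_zero_right, add_zero]
    ring

theorem inner_wedge_eq_of_parallel (hmetric : nabla.IsMetricCompatible)
    (hc : MDifferentiable 𝓘(ℝ, ℝ) IT c) (hΩ : ∀ t, HasCovDerivAlongAt₂ nabla c Ω t 0)
    (hξ : IsParallelAlong nabla c ξ) (hη : IsParallelAlong nabla c η) (t t' : ℝ) :
    ⟪Ω t, wedge (ξ t) (η t)⟫ = ⟪Ω t', wedge (ξ t') (η t')⟫ := by
  have h (t : ℝ) : HasDerivAt (fun τ => ⟪Ω τ, wedge (ξ τ) (η τ)⟫) 0 t := by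
    simpa using (hΩ t).hasDerivAt_inner_wedge hmetric (hc t) (hξ t) (hη t)
  exact is_const_of_deriv_eq_zero (fun t => (h t).differentiableAt) (fun t => (h t).deriv) t t'

end Parallel

section Monodromy

theorem mdifferentiable_circleExp : MDifferentiable 𝓘(ℝ, ℝ) (𝓡 1) Circle.exp :=
  (contMDiff_circleExp (m := 1)).mdifferentiable one_ne_zero

theorem mdifferentiable_curveX : MDifferentiable 𝓘(ℝ, ℝ) IT curveX :=
  have h : MDifferentiable 𝓘(ℝ, ℝ) (𝓡 1) fun _ : ℝ => Circle.exp 0 := mdifferentiable_const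
  mdifferentiable_circleExp.prodMk h

theorem mdifferentiable_curveY : MDifferentiable 𝓘(ℝ, ℝ) IT curveY :=
  have h : MDifferentiable 𝓘(ℝ, ℝ) (𝓡 1) fun _ : ℝ => Circle.exp 0 := mdifferentiable_const
  h.prodMk mdifferentiable_circleExp

variable {E : Torus → Type*} [∀ b, NormedAddCommGroup (E b)] [∀ b, InnerProductSpace ℝ (E b)]
  [∀ b, FiniteDimensional ℝ (E b)]

theorem inner_wedge_congr {b b' : Torus} {w : ⋀[ℝ]^2 (E b)} {w' : ⋀[ℝ]^2 (E b')} {x y : E b}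
    {x' y' : E b'} (hw : (⟨b, w⟩ : Σ b, ⋀[ℝ]^2 (E b)) = ⟨b', w'⟩)
    (hx : (⟨b, x⟩ : Σ b, E b) = ⟨b', x'⟩) (hy : (⟨b, y⟩ : Σ b, E b) = ⟨b', y'⟩) :
    ⟪w, wedge x y⟫ = ⟪w', wedge x' y'⟫ := by
  cases hw
  cases hx
  cases hy
  rfl

variable [TopologicalSpace (Bundle.TotalSpace R4 E)] [FiberBundle R4 E] [VectorBundle ℝ R4 E]
  [ContMDiffVectorBundle 1 R4 E IT] [IsContMDiffRiemannianBundle IT 1 R4 E]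
  {nabla : CovariantDerivative IT R4 E} {c : ℝ → Torus} {Ω : Fin 3 → ∀ t, ⋀[ℝ]^2 (E (c t))}
  {ξ : Fin 4 → ∀ t, E (c t)} {C : specialOrthogonalGroup (Fin 3) ℝ}
  {A : specialOrthogonalGroup (Fin 4) ℝ}

theorem mul_bivectorMatrix_mul_transpose_of_hasMonodromy (hmetric : nabla.IsMetricCompatible)
    (hc : MDifferentiable 𝓘(ℝ, ℝ) IT c) (hΩ : ∀ k t, HasCovDerivAlongAt₂ nabla c (Ω k) t 0)
    (hξ : ∀ i, IsParallelAlong nabla c (ξ i))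
    (hC : HasMonodromy (G := fun b => ⋀[ℝ]^2 (E b)) Ω C.1) (hA : HasMonodromy ξ A.1) (k : Fin 3) :
    A.1 * bivectorMatrix (ξ · 0) (Ω k 0) * A.1ᵀ =
      bivectorMatrix (ξ · 0) (∑ l, C.1 l k • Ω l 0) := by
  have h : bivectorMatrix (ξ · 0) (Ω k 0) =
      bivectorMatrix (fun i => ∑ a, A.1ᵀ i a • ξ a 0) (∑ l, C.1 l k • Ω l 0) := by
    ext i j
    rw [bivectorMatrix_apply, bivectorMatrix_apply,
      inner_wedge_eq_of_parallel hmetric hc (hΩ k) (hξ i) (hξ j) 0 (0 + 2 * π)]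
    exact inner_wedge_congr (hC 0 k) (hA 0 i) (hA 0 j)
  rw [h, bivectorMatrix_sum_smul, transpose_transpose, mul_assoc, mul_assoc,
    specialOrthogonal_mul_transpose, mul_one, ← mul_assoc, specialOrthogonal_mul_transpose,
    one_mul]

theorem mem_adjointPairs_of_hasMonodromy (hmetric : nabla.IsMetricCompatible)
    (hc : MDifferentiable 𝓘(ℝ, ℝ) IT c) (hΩ : ∀ k t, HasCovDerivAlongAt₂ nabla c (Ω k) t 0)
    (hξ : ∀ i, IsParallelAlong nabla c (ξ i))
    (hC : HasMonodromy (G := fun b => ⋀[ℝ]^2 (E b)) Ω C.1) {g : ℤˣ → unitary ℍ[ℝ]}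
    (hA : HasMonodromy ξ (spin g).1) {ε : ℤˣ} {Φ : (Fin 3 → ℝ) →ₗ[ℝ] ℍ[ℝ]}
    (hΦ : ∀ x, mulMatrix ε (Φ x) = bivectorMatrix (ξ · 0) (∑ k, x k • Ω k 0)) :
    (g ε, C) ∈ adjointPairs Φ := by
  refine mem_adjointPairs_of_single fun k => mulMatrix_injective ε ?_
  have hk : mulMatrix ε (Φ (Pi.single k 1)) = bivectorMatrix (ξ · 0) (Ω k 0) := by
    rw [hΦ, Fintype.sum_eq_single k fun l hl => by rw [Pi.single_eq_of_ne hl, zero_smul],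
      Pi.single_eq_same, one_smul]
  rw [← spin_mul_mulMatrix_mul_transpose, hk, hΦ,
    mul_bivectorMatrix_mul_transpose_of_hasMonodromy hmetric hc hΩ hξ hC hA]
  rfl

theorem exists_mem_adjointPairs (hmetric : nabla.IsMetricCompatible)
    {o : ∀ b, Orientation ℝ (E b) (Fin 4)} {ε : ℤˣ} {C₁ C₂ : specialOrthogonalGroup (Fin 3) ℝ}
    (hC : IsTwistorHolonomyPair nabla o ε C₁ C₂) {g h : ℤˣ → unitary ℍ[ℝ]}
    (hA : IsHolonomyPair nabla o (spin g) (spin h)) :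
    ∃ Φ : (Fin 3 → ℝ) →ₗ[ℝ] ℍ[ℝ], Function.Injective Φ ∧ (g ε, C₁) ∈ adjointPairs Φ ∧
      (h ε, C₂) ∈ adjointPairs Φ := by
  obtain ⟨v, ξx, ξy, hv, hξx, hξy, hAx, hAy⟩ := hA
  obtain ⟨w, Ωx, Ωy, hw, hΩx, hΩy, hCx, hCy⟩ := hC
  obtain ⟨Φ, hinj, hΦ⟩ :=
    exists_injective_bivectorMatrix_eq hv hw.mem hw.orthonormal.linearIndependent
  refine ⟨Φ, hinj, ?_, ?_⟩
  · refine mem_adjointPairs_of_hasMonodromy hmetric mdifferentiable_curveX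
      (fun k t => ((hΩx k).1 t).2) (fun i => (hξx i).1) hCx hAx fun x => ?_
    simp only [hΦ, (hξx _).2, (hΩx _).2]
  · refine mem_adjointPairs_of_hasMonodromy hmetric mdifferentiable_curveY
      (fun k t => ((hΩy k).1 t).2) (fun i => (hξy i).1) hCy hAy fun x => ?_
    simp only [hΦ, (hξy _).2, (hΩy _).2]

end Monodromy

theorem dense_closure_spin {g h : ℤˣ → unitary ℍ[ℝ]} (hfin : IsOfFinOrder (h (-1)))
    (hord : ¬ IsOfFinOrder (h 1)) (hcomm : ¬ Commute (h 1) (g 1 * h 1 * (g 1)⁻¹))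
    (hord' : ¬ IsOfFinOrder (g (-1)))
    (hcomm' : ¬ Commute (g (-1)) (h (-1) * g (-1) * (h (-1))⁻¹)) :
    Dense (Subgroup.closure {spin g, spin h} : Set (specialOrthogonalGroup (Fin 4) ℝ)) := by
  let H : Subgroup (ℤˣ → unitary ℍ[ℝ]) := (Subgroup.closure {spin g, spin h}).comap spin
  have hg : g ∈ H := Subgroup.subset_closure (Set.mem_insert _ _)
  have hh : h ∈ H := Subgroup.subset_closure (Set.mem_insert_of_mem _ rfl)
  have htop : H.topologicalClosure = ⊤ :=
    eq_top_of_not_commute_conj H.isClosed_topologicalClosure (H.le_topologicalClosure hg)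
      (H.le_topologicalClosure hh) hfin hord hcomm hord' hcomm'
  have hdense : Dense (H : Set (ℤˣ → unitary ℍ[ℝ])) := fun k =>
    (htop ▸ Subgroup.mem_top k : k ∈ H.topologicalClosure)
  exact (spin_surjective.denseRange.dense_image continuous_spin hdense).mono
    (Set.image_preimage_subset _ _)

theorem sin_ne_zero_of_div_pi_ne_intCast {θ : ℝ} (hθ : ∀ n : ℤ, θ / π ≠ n) : Real.sin θ ≠ 0 :=
  Real.sin_ne_zero_iff.2 fun n hn => hθ n (by rw [← hn, mul_div_cancel_right₀ _ Real.pi_ne_zero])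

end TorusHolonomy

end

theorem theorem4p5_general
    {E : Torus → Type*} [TopologicalSpace (Bundle.TotalSpace R4 E)]
    [∀ b, NormedAddCommGroup (E b)] [∀ b, InnerProductSpace ℝ (E b)]
    [∀ b, FiniteDimensional ℝ (E b)]
    [FiberBundle R4 E] [VectorBundle ℝ R4 E] [ContMDiffVectorBundle 1 R4 E IT]
    [IsContMDiffRiemannianBundle IT 1 R4 E]
    (o : ∀ b, Orientation ℝ (E b) (Fin 4)) (nabla : CovariantDerivative IT R4 E)
    (hmetric : nabla.IsMetricCompatible)
    (C : ℤˣ → Fin 2 → Matrix.specialOrthogonalGroup (Fin 3) ℝ)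
    (hC : ∀ ε, IsTwistorHolonomyPair nabla o ε (C ε 0) (C ε 1))
    (θ : ℤˣ → Fin 2 → ℝ) (p : ℤˣ → Fin 2 → EuclideanSpace ℝ (Fin 3))
    (hrot : ∀ ε k, IsRotation (C ε k) (θ ε k) (p ε k))
    (hangle : ∀ ε, InnerProductGeometry.angle (p ε 0) (p ε 1) ∈ Set.Ioo 0 π)
    (hθ₁ : ∀ n : ℤ, θ 1 0 / π ≠ n) (hθ₂ : Irrational (θ 1 1 / π))
    (hθ₃ : Irrational (θ (-1) 0 / π)) (hθ₄ : ∀ n : ℤ, θ (-1) 1 / π ≠ n)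
    (hθ₄' : ¬ Irrational (θ (-1) 1 / π))
    (G : Subgroup (Matrix.specialOrthogonalGroup (Fin 4) ℝ))
    (hG : IsTopHolonomyGroup nabla o G) :
    Dense (G : Set (Matrix.specialOrthogonalGroup (Fin 4) ℝ)) := by
  obtain ⟨A₁, A₂, hA, rfl⟩ := hG
  obtain ⟨g, rfl⟩ := spin_surjective A₁
  obtain ⟨h, rfl⟩ := spin_surjective A₂
  choose Φ hΦ hg hh using fun ε => exists_mem_adjointPairs hmetric (hC ε) hA
  have hord ε : (IsOfFinOrder (g ε) ↔ ¬ Irrational (θ ε 0 / π)) ∧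
      (IsOfFinOrder (h ε) ↔ ¬ Irrational (θ ε 1 / π)) :=
    ⟨(isOfFinOrder_iff_of_mem_adjointPairs (hΦ ε) (hg ε)).trans (hrot ε 0).isOfFinOrder_iff,
      (isOfFinOrder_iff_of_mem_adjointPairs (hΦ ε) (hh ε)).trans (hrot ε 1).isOfFinOrder_iff⟩
  refine dense_closure_spin ((hord _).2.2 hθ₄') (fun hfin => (hord _).2.1 hfin hθ₂) ?_
    (fun hfin => (hord _).1.1 hfin hθ₃) ?_
  · refine not_commute_conj_of_mem_adjointPairs (hΦ 1) (hh 1) (hg 1) ?_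
    exact (hrot 1 1).not_commute_conj (hrot 1 0) (sin_ne_zero_of_div_pi_ne_intCast hθ₂.ne_int)
      (sin_ne_zero_of_div_pi_ne_intCast hθ₁)
      (InnerProductGeometry.angle_comm (p 1 0) (p 1 1) ▸ hangle 1)
  · refine not_commute_conj_of_mem_adjointPairs (hΦ (-1)) (hg (-1)) (hh (-1)) ?_
    exact (hrot (-1) 0).not_commute_conj (hrot (-1) 1)
      (sin_ne_zero_of_div_pi_ne_intCast hθ₃.ne_int) (sin_ne_zero_of_div_pi_ne_intCast hθ₄)
      (hangle (-1))

/-- `E` is a smooth oriented real vector bundle of rank `4` over the torus with a smooth metric, and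
`nabla` is a smooth metric connection. The index `0`, `1` of `C ε`, `p ε` stands for the circle in the
first, second direction. -/
theorem theorem4p5
    {E : Torus → Type*} [TopologicalSpace (Bundle.TotalSpace R4 E)]
    [∀ b, NormedAddCommGroup (E b)] [∀ b, InnerProductSpace ℝ (E b)]
    [∀ b, FiniteDimensional ℝ (E b)]
    [FiberBundle R4 E] [VectorBundle ℝ R4 E] [ContMDiffVectorBundle ∞ R4 E IT]
    [IsContMDiffRiemannianBundle IT ∞ R4 E]
    (o : ∀ b, Orientation ℝ (E b) (Fin 4)) (ho : IsBundleOrientation o)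
    (nabla : CovariantDerivative IT R4 E)
    (hsmooth : CovariantDerivative.ContMDiffCovariantDerivative nabla ∞)
    (hmetric : nabla.IsMetricCompatible)
    (C : ℤˣ → Fin 2 → Matrix.specialOrthogonalGroup (Fin 3) ℝ)
    (hC : ∀ ε, IsTwistorHolonomyPair nabla o ε (C ε 0) (C ε 1))
    (θ : ℤˣ → Fin 2 → ℝ) (p : ℤˣ → Fin 2 → EuclideanSpace ℝ (Fin 3))
    (hrot : ∀ ε k, IsRotation (C ε k) (θ ε k) (p ε k))
    (φ : ℤˣ → ℝ) (hφ : ∀ ε, φ ε = InnerProductGeometry.angle (p ε 0) (p ε 1))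
    (hφ_mem : ∀ ε, φ ε ∈ Set.Ioc 0 (π / 2))
    (q₁ q₂ : ℚ) (hq₁ : ∀ n : ℤ, q₁ ≠ n) (hq₂ : ∀ n : ℤ, q₂ ≠ n)
    (ψ₁ ψ₂ : ℝ) (hψ₁ : Irrational ψ₁) (hψ₂ : Irrational ψ₂)
    (hθ₁ : θ 1 0 = q₁ * π) (hθ₂ : θ 1 1 = ψ₂ * π)
    (hθ₃ : θ (-1) 0 = ψ₁ * π) (hθ₄ : θ (-1) 1 = q₂ * π)
    (G : Subgroup (Matrix.specialOrthogonalGroup (Fin 4) ℝ))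
    (hG : IsTopHolonomyGroup nabla o G) :
    Dense (G : Set (Matrix.specialOrthogonalGroup (Fin 4) ℝ)) := by
  have hdiv (r : ℝ) : r * π / π = r := mul_div_cancel_right₀ r Real.pi_ne_zero
  have hangle (ε : ℤˣ) : InnerProductGeometry.angle (p ε 0) (p ε 1) ∈ Set.Ioo 0 π :=
    hφ ε ▸ ⟨(hφ_mem ε).1, (hφ_mem ε).2.trans_lt (half_lt_self Real.pi_pos)⟩
  refine theorem4p5_general o nabla hmetric C hC θ p hrot hangle ?_ ?_ ?_ ?_ ?_ G hG <;>
    simp only [hθ₁, hθ₂, hθ₃, hθ₄, hdiv]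
  exacts [mod_cast hq₁, hψ₂, hψ₁, mod_cast hq₂, q₂.not_irrational]
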